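/- Conventions. Let $p$ be a prime; all fields below are algebraic over $\mathbb{Q}_p$, and $[x,y]=x^{-1}y^{-1}xy$. For a totally ramified Galois extension $M/F$ with $F$ finite over $\mathbb{Q}_p$, let $G^u$ ($u\ge 0$) be the upper ramification filtration of $G=\mathrm{Gal}(M/F)$ (for infinite $M/F$, the inverse limit of the upper ramification groups of the finite Galois subextensions), and for $\sigma\in G$ put $u_G(\sigma)=\sup\{u\ge 0:\sigma\in G^u\}\in[0,\infty]$. The extension $M/F$ is *arithmetically profinite* (APF) if it is totally ramified and $G^x$ is non-trivial and open in $G$ for every real $x\ge 0$. A set of *PC-generators* of an infinite pro-$p$-group $G$ is a sequence $g_0,g_1,\dots$ for which there is a descending chain $G=\Gamma_0\supseteq\Gamma_1\supseteq\cdots$ of open normal subgroups with $\bigcap_k\Gamma_k=1$, $[\Gamma_k,G]\subseteq\Gamma_{k+1}$, $(\Gamma_k:\Gamma_{k+1})=p$ and $g_k\in\Gamma_k\setminus\Gamma_{k+1}$. A *$C$-tower* is a sequence $c_1,c_2,c_3,\dots$ of elements of a set of PC-generators with $$c_3=[c_1,c_2],\qquad c_4=[c_3,c_2],\qquad c_{k+1}=[c_k,c_{k-1}]\quad(k\ge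 3).$$ A *$C$-group* is an infinite pro-$p$-group $G$ with a set $I$ of PC-generators containing a $C$-tower $C$ such that the closed subgroup $N$ generated by $I\setminus C$ satisfies $\bigcap_{g\in G}g^{-1}Ng=1$. A *$C$-extension* is a Galois extension whose Galois group is a $C$-group; such a $C$ is called a defining $C$-tower. Statement. Let $K$ be a finite extension of $\mathbb{Q}_p$ and let $E/K$ be a totally ramified Galois pro-$p$-extension whose Galois group $G=\mathrm{Gal}(E/K)$ is topologically generated by two elements. Suppose that $E$ is the compositum of a finite non-empty family of subextensions $E_k/K$ ($1\le k\le n$), each containing a finite subextension $L_k/K$ such that $E_k/L_k$ is a $C$-extension. For each $k$ let $(a_{k,i})_{i\ge 1}$ be elements of $\mathrm{Gal}(E/L_k)\subseteq G$ which satisfy the commutator relations of a $C$-tower displayed above and whose restrictions to $E_k$ form a defining $C$-tower of $\mathrm{Gal}(E_k/L_k)$. Suppose that $$u_G(a_{k,i}a_{l,i})=\min\{u_G(a_{k,i}),\,u_G(a_{l,i})\}\qquad\text{for all } k\ne l \text{ and all } i\ge 1,$$ and that all the $C$-extensions $E_k/L_k$ are APF. Then $E/K$ is APF. -/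

import Mathlib

open scoped NNReal ENNReal

noncomputable section

/-! ### Pro-`p`-groups, PC-generators, `C`-towers and `C`-groups -/

/-- A topological group is a pro-`p`-group if it is profinite and every open normal subgroup has
index a power of `p`. -/
structure IsProP (p : ℕ) (G : Type*) [Group G] [TopologicalSpace G] [IsTopologicalGroup G] :
    Prop where
  compact : CompactSpace G
  totallyDisconnected : TotallyDisconnectedSpace G
  index_eq_pow : ∀ U : Subgroup G, U.Normal → IsOpen (U : Set G) → ∃ n : ℕ, U.index = p ^ n

/-- A topological group is generated (topologically) by two elements. -/
def IsTwoGenerated (G : Type*) [Group G] [TopologicalSpace G] [IsTopologicalGroup G] : Prop :=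
  ∃ x y : G, (Subgroup.closure {x, y}).topologicalClosure = ⊤

/-- `g 0, g 1, …` is a set of PC-generators of the (infinite) pro-`p`-group `G`: there is a
central series `G = Γ 0 ⊇ Γ 1 ⊇ …` of open normal subgroups with trivial intersection (so that
`G = lim G / Γ k`) and successive quotients of order `p`, with `g k ∈ Γ k \ Γ (k + 1)`. -/
def IsPCGenerators (p : ℕ) {G : Type*} [Group G] [TopologicalSpace G] (g : ℕ → G) : Prop :=
  ∃ Γ : ℕ → Subgroup G,
    Γ 0 = ⊤ ∧ (⨅ k, Γ k) = ⊥ ∧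
    ∀ k, (Γ k).Normal ∧ IsOpen (Γ k : Set G) ∧ Γ (k + 1) ≤ Γ k ∧
      ⁅Γ k, (⊤ : Subgroup G)⁆ ≤ Γ (k + 1) ∧ (Γ (k + 1)).relIndex (Γ k) = p ∧
      g k ∈ Γ k ∧ g k ∉ Γ (k + 1)

/-- The commutator `[x, y] = x⁻¹ y⁻¹ x y`. -/
def comm' {G : Type*} [Group G] (x y : G) : G := x⁻¹ * y⁻¹ * x * y

/-- The relations of a `C`-tower `c 0, c 1, c 2, …` :
`c 2 = [c 0, c 1]`, `c 3 = [c 2, c 1]`, and in general `c (k + 2) = [c (k + 1), c k]` for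
`k ≥ 1`. -/
def SatisfiesCTowerRelations {G : Type*} [Group G] (c : ℕ → G) : Prop :=
  c 2 = comm' (c 0) (c 1) ∧ ∀ k, 1 ≤ k → c (k + 2) = comm' (c (k + 1)) (c k)

/-- `c` is a `C`-tower in `G` with respect to the PC-generators `g`. -/
def IsCTower {G : Type*} [Group G] (g c : ℕ → G) : Prop :=
  (∀ k, ∃ i, c k = g i) ∧ SatisfiesCTowerRelations c

/-- `G` is a `C`-group with defining `C`-tower `c`: an infinite pro-`p`-group with a set `I` of
PC-generators containing the `C`-tower `c`, such that the closed subgroup `N` generated by the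
PC-generators outside the tower satisfies `⋂ g, g⁻¹ N g = 1`. -/
def IsCGroupWith (p : ℕ) {G : Type*} [Group G] [TopologicalSpace G] [IsTopologicalGroup G]
    (c : ℕ → G) : Prop :=
  IsProP p G ∧ Infinite G ∧
    ∃ g : ℕ → G, IsPCGenerators p g ∧ IsCTower g c ∧
      (Subgroup.closure (Set.range g \ Set.range c)).topologicalClosure.normalCore = ⊥

/-! ### Ramification over `ℚ_p` -/

instance isScalarTower_intermediateField {R K E : Type*} [CommSemiring R] [Field K] [Field E]
    [Algebra R K] [Algebra K E] [Algebra R E] [IsScalarTower R K E]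
    (L : IntermediateField K E) : IsScalarTower R L E :=
  IsScalarTower.of_algebraMap_eq fun _ => rfl

section Ramification

variable (p : ℕ) [Fact p.Prime]

/-- The ring of integers of an algebraic extension `M` of `ℚ_p`: the integral closure of `ℤ_p`
in `M`. -/
def ringOfInt (M : Type*) [Field M] [Algebra ℚ_[p] M] : Subring M :=
  letI : Algebra ℤ_[p] M := ((algebraMap ℚ_[p] M).comp PadicInt.Coe.ringHom).toAlgebra
  (integralClosure ℤ_[p] M).toSubring

/-- The maximal ideal of the ring of integers of an algebraic extension `M` of `ℚ_p`. That ring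
is local, so its maximal ideal consists of its nonunits. -/
def maxIdeal (M : Type*) [Field M] [Algebra ℚ_[p] M] : Ideal (ringOfInt p M) :=
  Ideal.span (nonunits (ringOfInt p M))

variable (F M : Type*) [Field F] [Field M] [Algebra F M] [Algebra ℚ_[p] F] [Algebra ℚ_[p] M]

/-- An algebraic extension `M / F`, with `F` finite over `ℚ_p`, is totally ramified if it has
trivial residue field extension. -/
def IsTotallyRamified : Prop :=
  ∀ x : ringOfInt p M, ∃ y : ringOfInt p F, ∃ z ∈ maxIdeal p M,
    (x : M) = algebraMap F M (y : F) + (z : M)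

variable [IsScalarTower ℚ_[p] F M]

variable {F M} in
lemma map_mem_ringOfInt (σ : Gal(M/F)) {x : M} (hx : x ∈ ringOfInt p M) :
    σ x ∈ ringOfInt p M := by
  let _ : Algebra ℤ_[p] M := ((algebraMap ℚ_[p] M).comp PadicInt.Coe.ringHom).toAlgebra
  have hx' : IsIntegral ℤ_[p] x := hx
  have h : IsIntegral ℤ_[p] (σ x) := by
    obtain ⟨f, hf, hfx⟩ := hx'
    refine ⟨f, hf, ?_⟩
    have hc : (σ : M →+* M).comp (algebraMap ℤ_[p] M) = algebraMap ℤ_[p] M := by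
      ext z
      change σ (algebraMap ℚ_[p] M (z : ℚ_[p])) = algebraMap ℚ_[p] M (z : ℚ_[p])
      rw [IsScalarTower.algebraMap_apply ℚ_[p] F M, AlgEquiv.commutes]
    have := congrArg (σ : M →+* M) hfx
    rw [Polynomial.hom_eval₂, hc, map_zero] at this
    exact this
  exact h

/-- The ramification group `G_s` in the lower numbering of a finite Galois extension `M / F` of
`p`-adic fields, for real `s ≥ 0`: those `σ` with `v_M (σ x - x) ≥ s + 1` for all integers `x` of
`M`, where `v_M` is the normalised valuation. -/
def lowerRam (s : ℝ) : Subgroup Gal(M/F) where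
  carrier := {σ | ∀ x : ringOfInt p M, ∃ y ∈ maxIdeal p M ^ (⌈s⌉₊ + 1), (y : M) = σ (x : M) - x}
  one_mem' x := ⟨0, Ideal.zero_mem _, by simp⟩
  mul_mem' := by
    intro σ τ hσ hτ x
    obtain ⟨y, hy, hy'⟩ := hτ x
    obtain ⟨z, hz, hz'⟩ := hσ ⟨τ (x : M), map_mem_ringOfInt p τ x.2⟩
    refine ⟨z + y, Ideal.add_mem _ hz hy, ?_⟩
    push_cast
    rw [hy', hz']
    simp
  inv_mem' := by
    intro σ hσ x
    obtain ⟨y, hy, hy'⟩ := hσ ⟨σ⁻¹ (x : M), map_mem_ringOfInt p σ⁻¹ x.2⟩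
    refine ⟨-y, (Ideal.neg_mem_iff _).2 hy, ?_⟩
    push_cast
    rw [hy']
    simp

/-- The function `φ t = ∫₀ᵗ ds / [G_0 : G_s]` of a finite Galois extension `M / F` of `p`-adic
fields, for `t ≥ 0`. -/
def herbrandPhi (t : ℝ) : ℝ :=
  ∫ s in (0 : ℝ)..t, (Nat.card (lowerRam p F M s) : ℝ) / (Nat.card (lowerRam p F M 0) : ℝ)

/-- The Herbrand function `h_{M/F}` of a finite Galois extension `M / F` of `p`-adic fields: the
inverse of the increasing bijection `φ : [0, ∞) → [0, ∞)`. -/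
def herbrand (u : ℝ) : ℝ := sInf {t : ℝ | 0 ≤ t ∧ u ≤ herbrandPhi p F M t}

/-- The ramification group `G^u = G_{h(u)}` in the upper numbering of a finite Galois extension
`M / F` of `p`-adic fields, for real `u ≥ 0`. -/
def upperRamFinite (u : ℝ) : Subgroup Gal(M/F) := lowerRam p F M (herbrand p F M u)

/-- The ramification group `G^u` in the upper numbering of a (possibly infinite) Galois extension
`M / F`, with `F` finite over `ℚ_p`: the inverse limit of the upper ramification groups of the
finite Galois subextensions. -/
def upperRam (u : ℝ) : Subgroup Gal(M/F) :=
  ⨅ M' : FiniteGaloisIntermediateField F M,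
    (upperRamFinite p F M' u).comap (AlgEquiv.restrictNormalHom (M' : IntermediateField F M))

/-- The Galois extension `M / F`, with `F` finite over `ℚ_p`, is arithmetically profinite: it is
totally ramified and for every `x ≥ 0` the ramification group `G^x` is non-trivial and open. -/
structure IsAPF : Prop where
  totallyRamified : IsTotallyRamified p F M
  upperRam_ne_bot : ∀ x : ℝ, 0 ≤ x → upperRam p F M x ≠ ⊥
  isOpen_upperRam : ∀ x : ℝ, 0 ≤ x → IsOpen (upperRam p F M x : Set Gal(M/F))

variable {F M} in
/-- The upper ramification break `u_G(σ) = sup {u ≥ 0 : σ ∈ G^u} ∈ [0, ∞]` of an element of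
`G = Gal(M/F)`. -/
def upperBreak (σ : Gal(M/F)) : ℝ≥0∞ :=
  ⨆ (u : ℝ≥0) (_ : σ ∈ upperRam p F M (u : ℝ)), (u : ℝ≥0∞)

end Ramification

/-- `M / F` is a `C`-extension, with `C`-tower `c` in `Gal(M/F)`. -/
def IsCExtensionWith (p : ℕ) (F M : Type*) [Field F] [Field M] [Algebra F M]
    (c : ℕ → Gal(M/F)) : Prop :=
  IsGalois F M ∧ IsCGroupWith p c

end

/-! Write `R = G^x` and `N_k = Gal(E/E_k)`. The issue is to show that `R` is open.

Since `E_k/L_k` is APF, its upper ramification groups are open. Upper ramification groups lift from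
quotients (Herbrand), and `G^x` contains `Gal(E/L_k)^y` for a suitable `y` (base change). Hence `N_k
R` is open in `Gal(E/L_k)` (`isOpen_fixingSubgroup_sup_upperRam`). The `N_k` intersect trivially
because `E` is the compositum. After passing to an open normal subgroup inside all `Gal(E/L_k)`, the
`N_k` become normal, and it remains to pass from the openness of every `N_k R` to that of `(⋂ N_k) R
= R`.

This is done one `k` at a time (`isOpen_of_isOpen_sup`). For normal `X`, `Y` one has `[XR, YR] ⊆ (X
∩ Y)R`. So if `W` is open and lies in `XR ∩ YR`, then the closure `A` of `[W,W]R` lies in `(X ∩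
Y)R`, and it suffices that `A` is open. The quotient `W/A` is abelian with bounded upper
ramification. It has finite exponent (`exists_pow_mem`), because a totally ramified cyclic extension
of degree `p^n` has upper breaks growing linearly in `n` (`le_of_upperRamFinite_eq_bot`). It is
topologically finitely generated because `G` is. So it is finite (`isOpen_of_pow_mem`).

Non-triviality of `G^x` follows by lifting a non-trivial element of `Gal(E_k/L_k)^y`.

The ramification theory rests on one multiplicative criterion, `mem_upperRamFinite_iff`: `σ ∈ G^u`
exactly when the product over `τ` of `max(|τπ-π|, |σπ-π|)` is at most `|π_F|^(1+u)`. Quotients, base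
change and cyclic extensions are all handled by estimating this product. -/

set_option linter.unusedSectionVars false

/-! ### The absolute value of an algebraic extension of `ℚ_p` -/

section AbsoluteValue

variable (p : ℕ) [Fact p.Prime]

/-- The absolute value of an algebraic extension of `ℚ_p` which extends the `p`-adic one. -/
noncomputable def nm (M : Type*) [Field M] [Algebra ℚ_[p] M] [Algebra.IsAlgebraic ℚ_[p] M] : M →*₀ ℝ where
  toFun := spectralMulAlgNorm ℚ_[p] M
  map_zero' := map_zero _
  map_one' := map_one _
  map_mul' := map_mul _

variable {M : Type*} [Field M] [Algebra ℚ_[p] M] [Algebra.IsAlgebraic ℚ_[p] M]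

lemma nm_apply (x : M) : nm p M x = spectralNorm ℚ_[p] M x := rfl

lemma nm_nonneg (x : M) : 0 ≤ nm p M x := spectralNorm_nonneg x

lemma nm_neg (x : M) : nm p M (-x) = nm p M x := map_neg_eq_map (spectralMulAlgNorm ℚ_[p] M) x

lemma nm_sub_comm (x y : M) : nm p M (x - y) = nm p M (y - x) := by
  rw [← nm_neg, neg_sub]

lemma nm_pos {x : M} (hx : x ≠ 0) : 0 < nm p M x :=
  lt_of_le_of_ne (nm_nonneg p x) (Ne.symm ((map_ne_zero _).2 hx))

lemma nm_add_le (x y : M) : nm p M (x + y) ≤ max (nm p M x) (nm p M y) :=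
  isNonarchimedean_spectralNorm (K := ℚ_[p]) x y

lemma nm_sub_le (x y : M) : nm p M (x - y) ≤ max (nm p M x) (nm p M y) := by
  rw [sub_eq_add_neg, ← nm_neg p y]; exact nm_add_le p x (-y)

lemma nm_add_le_of_le {x y : M} {r : ℝ} (hx : nm p M x ≤ r) (hy : nm p M y ≤ r) :
    nm p M (x + y) ≤ r := (nm_add_le p x y).trans (max_le hx hy)

lemma nm_sub_le_of_le {x y : M} {r : ℝ} (hx : nm p M x ≤ r) (hy : nm p M y ≤ r) :
    nm p M (x - y) ≤ r := (nm_sub_le p x y).trans (max_le hx hy)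

lemma nm_add_lt {x y : M} {r : ℝ} (hx : nm p M x < r) (hy : nm p M y < r) :
    nm p M (x + y) < r := (nm_add_le p x y).trans_lt (max_lt hx hy)

lemma nm_sum_le {ι : Type*} (s : Finset ι) (f : ι → M) {r : ℝ} (hr : 0 ≤ r)
    (h : ∀ i ∈ s, nm p M (f i) ≤ r) : nm p M (∑ i ∈ s, f i) ≤ r := by
  classical
  induction s using Finset.induction_on with
  | empty => simpa using hr
  | insert a s ha ih =>
    rw [Finset.sum_insert ha]
    exact nm_add_le_of_le p (h a (by simp)) (ih fun i hi => h i (by simp [hi]))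

lemma nm_padic (x : ℚ_[p]) : nm p M (algebraMap ℚ_[p] M x) = ‖x‖ := spectralNorm_extends x

lemma nm_prime : nm p M (p : M) = (p : ℝ)⁻¹ := by
  rw [← map_natCast (algebraMap ℚ_[p] M), nm_padic, Padic.norm_p]

lemma nm_prime_lt_one : nm p M (p : M) < 1 := by
  rw [nm_prime]
  exact inv_lt_one_of_one_lt₀ (by exact_mod_cast (Fact.out : p.Prime).one_lt)

lemma nm_prime_pos : 0 < nm p M (p : M) := by
  rw [nm_prime]
  exact inv_pos.2 (by exact_mod_cast (Fact.out : p.Prime).pos)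

lemma nm_algHom {M' : Type*} [Field M'] [Algebra ℚ_[p] M'] [Algebra.IsAlgebraic ℚ_[p] M']
    (i : M →ₐ[ℚ_[p]] M') (x : M) : nm p M' (i x) = nm p M x := by
  rw [nm_apply, nm_apply, spectralNorm, spectralNorm,
    minpoly.algHom_eq i (RingHom.injective (i : M →+* M'))]

/-- The spectral norm is at most 1 exactly when the minimal polynomial over `ℚ_p` has all its
coefficients in `ℤ_p`; as `ℤ_p` is integrally closed, this is integrality. -/
lemma mem_ringOfInt_iff (x : M) : x ∈ ringOfInt p M ↔ nm p M x ≤ 1 := by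
  let _ : Algebra ℤ_[p] M := ((algebraMap ℚ_[p] M).comp PadicInt.Coe.ringHom).toAlgebra
  have : IsScalarTower ℤ_[p] ℚ_[p] M := IsScalarTower.of_algebraMap_eq fun _ => rfl
  change IsIntegral ℤ_[p] x ↔ _
  have hint : IsIntegral ℚ_[p] x := (Algebra.IsAlgebraic.isAlgebraic x).isIntegral
  rw [nm_apply, spectralNorm, spectralValue_le_one_iff (minpoly.monic hint)]
  constructor
  · intro h n
    have := minpoly.isIntegrallyClosed_eq_field_fractions ℚ_[p] M h
    rw [Algebra.algebraMap_self, RingHom.id_apply] at this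
    rw [this, Polynomial.coeff_map]
    exact PadicInt.norm_le_one _
  · intro h
    have hl : minpoly ℚ_[p] x ∈ Polynomial.lifts (algebraMap ℤ_[p] ℚ_[p]) := by
      rw [Polynomial.lifts_iff_coeff_lifts]
      intro n
      exact ⟨⟨_, h n⟩, rfl⟩
    obtain ⟨q, hq, -, hm⟩ := Polynomial.lifts_and_natDegree_eq_and_monic hl (minpoly.monic hint)
    refine ⟨q, hm, ?_⟩
    have h0 := minpoly.aeval ℚ_[p] x
    rw [← hq, Polynomial.aeval_map_algebraMap] at h0
    exact h0

lemma mem_nonunits_ringOfInt_iff (x : ringOfInt p M) :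
    x ∈ nonunits (ringOfInt p M) ↔ nm p M (x : M) < 1 := by
  have hx := (mem_ringOfInt_iff p (x : M)).1 x.2
  rw [mem_nonunits_iff]
  constructor
  · intro h
    by_contra! h1
    have h1 : nm p M (x : M) = 1 := le_antisymm hx h1
    have h0 : (x : M) ≠ 0 := fun h0 => by simp [h0] at h1
    apply h
    refine IsUnit.of_mul_eq_one ⟨(x : M)⁻¹, (mem_ringOfInt_iff p _).2 (by simp [h1])⟩ ?_
    ext
    simp [h0]
  · rintro h ⟨u, rfl⟩
    have hy := (mem_ringOfInt_iff p ((u⁻¹ : (ringOfInt p M)ˣ) : M)).1 (Subtype.property _)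
    have h1 : ((u : ringOfInt p M) : M) * ((u⁻¹ : (ringOfInt p M)ˣ) : ringOfInt p M) = 1 := by
      rw [← Subring.coe_mul, Units.mul_inv, Subring.coe_one]
    have h2 := congrArg (nm p M) h1
    rw [map_mul, map_one] at h2
    nlinarith [nm_nonneg p ((u : ringOfInt p M) : M)]

lemma mem_maxIdeal_iff (x : ringOfInt p M) : x ∈ maxIdeal p M ↔ nm p M (x : M) < 1 := by
  constructor
  · intro h
    refine Submodule.span_induction (p := fun x _ => nm p M ((x : ringOfInt p M) : M) < 1)
      ?_ ?_ ?_ ?_ h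
    · exact fun x hx => (mem_nonunits_ringOfInt_iff p x).1 hx
    · simp
    · intro x y _ _ hx hy
      exact nm_add_lt p hx hy
    · intro a x _ hx
      have ha := (mem_ringOfInt_iff p (a : M)).1 a.2
      have : nm p M (a : M) * nm p M (x : M) < 1 := by
        nlinarith [nm_nonneg p (a : M), nm_nonneg p (x : M)]
      simpa using this
  · intro h
    exact Ideal.subset_span ((mem_nonunits_ringOfInt_iff p x).2 h)

/-- `π` is a uniformizer: it has the largest absolute value less than `1`. -/
structure IsUnif (π : M) : Prop where
  lt_one : nm p M π < 1
  le : ∀ x : M, nm p M x < 1 → nm p M x ≤ nm p M π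

variable {p} in
lemma IsUnif.pos {π : M} (h : IsUnif p π) : 0 < nm p M π :=
  (nm_prime_pos p).trans_le (h.le _ (nm_prime_lt_one p))

variable {p} in
lemma IsUnif.ne_zero {π : M} (h : IsUnif p π) : π ≠ 0 := fun h0 => by
  have := h.pos
  simp [h0] at this

variable {p} in
lemma IsUnif.exists_zpow {π : M} (h : IsUnif p π) {x : M} (hx : x ≠ 0) :
    ∃ k : ℤ, nm p M x = nm p M π ^ k := by
  obtain ⟨k, hk1, hk2⟩ := exists_mem_Ioc_zpow (nm_pos p hx) ((one_lt_inv₀ h.pos).2 h.lt_one)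
  refine ⟨-(k + 1), ?_⟩
  have h0 := h.pos
  rw [inv_zpow'] at hk1 hk2
  -- The choice of `k` puts this absolute value in the interval from `|π|` (excluded) to 1
  -- (included), where a uniformizer leaves only the value 1.
  have hle : nm p M (x * π ^ (k + 1)) = 1 := by
    have e : nm p M (x * π ^ (k + 1)) = nm p M x * nm p M π ^ (k + 1) := by simp
    have hp : 0 < nm p M π ^ (k + 1) := zpow_pos h0 _
    by_contra hne
    have hlt : nm p M (x * π ^ (k + 1)) < 1 := by
      refine lt_of_le_of_ne ?_ hne
      rw [e]
      calc _ ≤ nm p M π ^ (-(k + 1)) * nm p M π ^ (k + 1) := by gcongr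
        _ = 1 := by rw [← zpow_add₀ h0.ne']; simp
    have := h.le _ hlt
    rw [e] at this
    have h3 : nm p M π ^ (-k) * nm p M π ^ (k + 1) < nm p M x * nm p M π ^ (k + 1) := by gcongr
    rw [← zpow_add₀ h0.ne'] at h3
    simp only [neg_add_cancel_left, zpow_one] at h3
    linarith
  rw [map_mul, map_zpow₀] at hle
  rw [zpow_neg]
  exact eq_inv_of_mul_eq_one_left hle

variable {p} in
lemma IsUnif.zpow_le_iff {π : M} (h : IsUnif p π) {a b : ℤ} :
    nm p M π ^ a ≤ nm p M π ^ b ↔ b ≤ a :=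
  zpow_le_zpow_iff_right_of_lt_one₀ h.pos h.lt_one

variable (M) in
-- The open unit ball of an ultrametric space is also closed, hence compact here, so the absolute
-- value attains its maximum on it.
lemma exists_isUnif [FiniteDimensional ℚ_[p] M] : ∃ π : M, IsUnif p π := by
  let _ := spectralNorm.normedField ℚ_[p] M
  let _ : NormedSpace ℚ_[p] M := spectralNorm.normedSpace ℚ_[p] M
  have : ProperSpace M := FiniteDimensional.proper ℚ_[p] M
  have : IsUltrametricDist M := IsUltrametricDist.isUltrametricDist_of_isNonarchimedean_norm
    (isNonarchimedean_spectralNorm (K := ℚ_[p]) (L := M))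
  have hc : IsCompact (Metric.ball (0 : M) 1) :=
    Metric.isCompact_of_isClosed_isBounded (IsUltrametricDist.isClosed_ball 0 1)
      Metric.isBounded_ball
  obtain ⟨π, hπ, hmax⟩ := hc.exists_isMaxOn ⟨0, by simp⟩ continuous_norm.continuousOn
  refine ⟨π, mem_ball_zero_iff.1 hπ, fun x hx => hmax (mem_ball_zero_iff.2 hx)⟩

variable {p} in
lemma IsUnif.mem_maxIdeal_pow_iff {π : M} (h : IsUnif p π) (n : ℕ) (x : ringOfInt p M) :
    x ∈ maxIdeal p M ^ n ↔ nm p M (x : M) ≤ nm p M π ^ n := by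
  have hπO : π ∈ ringOfInt p M := (mem_ringOfInt_iff p π).2 h.lt_one.le
  have hspan : maxIdeal p M = Ideal.span {⟨π, hπO⟩} := by
    ext y
    rw [mem_maxIdeal_iff, Ideal.mem_span_singleton']
    constructor
    · intro hy
      refine ⟨⟨(y : M) / π, (mem_ringOfInt_iff p _).2 ?_⟩, ?_⟩
      · rw [map_div₀]
        exact div_le_one_of_le₀ (h.le _ hy) (nm_nonneg p _)
      · ext
        simp [h.ne_zero]
    · rintro ⟨a, rfl⟩
      have ha := (mem_ringOfInt_iff p (a : M)).1 a.2
      have : nm p M (a : M) * nm p M π < 1 := by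
        nlinarith [nm_nonneg p (a : M), h.lt_one, h.pos]
      simpa using this
  rw [hspan, Ideal.span_singleton_pow, Ideal.mem_span_singleton']
  constructor
  · rintro ⟨a, rfl⟩
    have ha := (mem_ringOfInt_iff p (a : M)).1 a.2
    have : nm p M (a : M) * nm p M π ^ n ≤ nm p M π ^ n :=
      mul_le_of_le_one_left (pow_nonneg (nm_nonneg p _) _) ha
    simpa using this
  · intro hx
    have h0 := h.ne_zero
    refine ⟨⟨(x : M) / π ^ n, (mem_ringOfInt_iff p _).2 ?_⟩, ?_⟩
    · rw [map_div₀, map_pow]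
      exact div_le_one_of_le₀ hx (pow_nonneg (nm_nonneg p _) _)
    · ext
      simp [h0]

end AbsoluteValue

/-! ### Finite totally ramified extensions -/

section Extension

variable (p : ℕ) [Fact p.Prime]
variable {F M : Type*} [Field F] [Field M] [Algebra F M] [Algebra ℚ_[p] F] [Algebra ℚ_[p] M]
  [IsScalarTower ℚ_[p] F M] [Algebra.IsAlgebraic ℚ_[p] F] [Algebra.IsAlgebraic ℚ_[p] M]

lemma nm_algebraMap (x : F) : nm p M (algebraMap F M x) = nm p F x :=
  nm_algHom p (IsScalarTower.toAlgHom ℚ_[p] F M) x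

lemma nm_algHom' {M' : Type*} [Field M'] [Algebra ℚ_[p] M'] [Algebra.IsAlgebraic ℚ_[p] M']
    [Algebra F M'] [IsScalarTower ℚ_[p] F M'] (i : M →ₐ[F] M') (x : M) :
    nm p M' (i x) = nm p M x :=
  nm_algHom p (i.restrictScalars ℚ_[p]) x

lemma nm_aut (σ : Gal(M/F)) (x : M) : nm p M (σ x) = nm p M x :=
  nm_algHom' p (σ : M →ₐ[F] M) x

lemma isTotallyRamified_iff : IsTotallyRamified p F M ↔
    ∀ x : M, nm p M x ≤ 1 → ∃ y : F, nm p F y ≤ 1 ∧ nm p M (x - algebraMap F M y) < 1 := by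
  constructor
  · intro h x hx
    obtain ⟨y, z, hz, e⟩ := h ⟨x, (mem_ringOfInt_iff p x).2 hx⟩
    refine ⟨y, (mem_ringOfInt_iff p _).1 y.2, ?_⟩
    have e' : x = algebraMap F M (y : F) + (z : M) := e
    rw [e', add_sub_cancel_left]
    exact (mem_maxIdeal_iff p z).1 hz
  · intro h x
    obtain ⟨y, hy, hxy⟩ := h x ((mem_ringOfInt_iff p _).1 x.2)
    refine ⟨⟨y, (mem_ringOfInt_iff p y).2 hy⟩,
      ⟨(x : M) - algebraMap F M y, (mem_ringOfInt_iff p _).2 hxy.le⟩,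
      (mem_maxIdeal_iff p _).2 hxy, ?_⟩
    simp

lemma nm_pow_sub_pow_le {a b : M} (ha : nm p M a ≤ 1) (hb : nm p M b ≤ 1) (i : ℕ) :
    nm p M (a ^ i - b ^ i) ≤ nm p M (a - b) := by
  induction i with
  | zero => simpa using nm_nonneg p _
  | succ i ih =>
    have e : a ^ (i + 1) - b ^ (i + 1) = a * (a ^ i - b ^ i) + (a - b) * b ^ i := by ring
    rw [e]
    refine nm_add_le_of_le p ?_ ?_
    · rw [map_mul]
      nlinarith [nm_nonneg p a, nm_nonneg p (a - b), nm_nonneg p (a ^ i - b ^ i)]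
    · rw [map_mul, map_pow]
      exact mul_le_of_le_one_right (nm_nonneg p _) (pow_le_one₀ (nm_nonneg p _) hb)

lemma nm_aeval_sub_le {g : Polynomial F} (hg : ∀ i, nm p F (g.coeff i) ≤ 1) {a b : M}
    (ha : nm p M a ≤ 1) (hb : nm p M b ≤ 1) :
    nm p M (Polynomial.aeval a g - Polynomial.aeval b g) ≤ nm p M (a - b) := by
  rw [Polynomial.aeval_eq_sum_range, Polynomial.aeval_eq_sum_range, ← Finset.sum_sub_distrib]
  refine nm_sum_le p _ _ (nm_nonneg p _) fun i _ => ?_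
  rw [← smul_sub, Algebra.smul_def, map_mul, nm_algebraMap]
  exact (mul_le_of_le_one_left (nm_nonneg p _) (hg i)).trans (nm_pow_sub_pow_le p ha hb i)

variable {p}

lemma IsTotallyRamified.of_algHom {M' : Type*} [Field M'] [Algebra F M'] [Algebra ℚ_[p] M']
    [IsScalarTower ℚ_[p] F M'] [Algebra.IsAlgebraic ℚ_[p] M'] (hTR : IsTotallyRamified p F M)
    (i : M' →ₐ[F] M) : IsTotallyRamified p F M' := by
  rw [isTotallyRamified_iff] at hTR ⊢
  intro x hx
  obtain ⟨y, hy, hxy⟩ := hTR (i x) (by rwa [nm_algHom'])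
  refine ⟨y, hy, ?_⟩
  rwa [← AlgHom.commutes i y, ← map_sub, nm_algHom'] at hxy

/-- Digits are peeled off one at a time: total ramification supplies a residue representative in
`F`, and the remainder is divided by `π`. -/
lemma IsTotallyRamified.exists_approx (hTR : IsTotallyRamified p F M) {π : M} (hπ : IsUnif p π)
    (j : ℕ) : ∀ x : M, nm p M x ≤ 1 → ∃ g : ℕ → F, (∀ i, nm p F (g i) ≤ 1) ∧
      nm p M (x - ∑ i ∈ Finset.range j, algebraMap F M (g i) * π ^ i) ≤ nm p M π ^ j := by
  induction j with
  | zero => intro x hx; exact ⟨0, by simp, by simpa using hx⟩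
  | succ j ih =>
    intro x hx
    obtain ⟨y, hy, hxy⟩ := (isTotallyRamified_iff p).1 hTR x hx
    obtain ⟨g, hg, hxg⟩ := ih ((x - algebraMap F M y) / π) (by
      rw [map_div₀]; exact div_le_one_of_le₀ (hπ.le _ hxy) (nm_nonneg p _))
    refine ⟨fun i => Nat.casesOn i y g, fun i => ?_, ?_⟩
    · cases i <;> simp [hy, hg]
    · rw [Finset.sum_range_succ']
      have h0 := hπ.ne_zero
      have e : x - (∑ i ∈ Finset.range j, algebraMap F M (g i) * π ^ (i + 1)
            + algebraMap F M y * π ^ 0) =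
          π * ((x - algebraMap F M y) / π - ∑ i ∈ Finset.range j, algebraMap F M (g i) * π ^ i) := by
        rw [mul_sub, Finset.mul_sum, mul_div_cancel₀ _ h0]
        simp only [pow_succ, pow_zero, mul_one]
        rw [sub_add_eq_sub_sub_swap]
        congr 1
        exact Finset.sum_congr rfl fun i _ => by ring
      change nm p M (x - (∑ i ∈ Finset.range j, algebraMap F M (g i) * π ^ (i + 1)
            + algebraMap F M y * π ^ 0)) ≤ _
      rw [e, map_mul, pow_succ']
      exact mul_le_mul_of_nonneg_left hxg (nm_nonneg p _)

lemma IsUnif.exists_ramificationIndex {πF : F} (hF : IsUnif p πF) {π : M} (hπ : IsUnif p π) :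
    ∃ e : ℕ, nm p F πF = nm p M π ^ e := by
  obtain ⟨k, hk⟩ := hπ.exists_zpow (x := algebraMap F M πF)
    ((map_ne_zero _).2 hF.ne_zero)
  rw [nm_algebraMap] at hk
  have : 0 ≤ k := by
    have := hF.lt_one.le
    rw [hk, ← zpow_zero (nm p M π), hπ.zpow_le_iff] at this
    exact this
  lift k to ℕ using this
  exact ⟨k, by simpa using hk⟩

/-- Blocks of `e` digits have remainder of size `|π|^e = |πF|`. Dividing by `πF` rather than `π^e`
keeps the exponents of `π` below `e` and moves all further precision into the coefficients. -/
lemma IsTotallyRamified.exists_approx_pow (hTR : IsTotallyRamified p F M) {πF : F}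
    (hF : IsUnif p πF) {π : M} (hπ : IsUnif p π) {e : ℕ} (he : nm p F πF = nm p M π ^ e)
    {x : M} (hx : nm p M x ≤ 1) (k : ℕ) : ∃ a : Fin e → F, (∀ i, nm p F (a i) ≤ 1) ∧
      nm p M (x - ∑ i, algebraMap F M (a i) * π ^ (i : ℕ)) ≤ nm p F πF ^ k := by
  induction k with
  | zero => exact ⟨0, by simp, by simpa using hx⟩
  | succ k ih =>
    obtain ⟨a, ha, hxa⟩ := ih
    have h0 : algebraMap F M πF ^ k ≠ 0 := pow_ne_zero _ ((map_ne_zero _).2 hF.ne_zero)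
    obtain ⟨g, hg, hxg⟩ := hTR.exists_approx hπ e
      ((x - ∑ i, algebraMap F M (a i) * π ^ (i : ℕ)) / algebraMap F M πF ^ k) (by
        rw [map_div₀, map_pow, nm_algebraMap]
        exact div_le_one_of_le₀ hxa (pow_nonneg (nm_nonneg p _) _))
    refine ⟨fun i => a i + πF ^ k * g i, fun i => nm_add_le_of_le p (ha i) ?_, ?_⟩
    · rw [map_mul, map_pow]
      exact mul_le_one₀ (pow_le_one₀ (nm_nonneg p _) hF.lt_one.le) (nm_nonneg p _) (hg i)
    · rw [Finset.sum_range, ← he] at hxg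
      have e1 : x - ∑ i : Fin e, algebraMap F M (a i + πF ^ k * g i) * π ^ (i : ℕ) =
          algebraMap F M πF ^ k * ((x - ∑ i : Fin e, algebraMap F M (a i) * π ^ (i : ℕ)) /
            algebraMap F M πF ^ k - ∑ i : Fin e, algebraMap F M (g i) * π ^ (i : ℕ)) := by
        rw [mul_sub, mul_div_cancel₀ _ h0, Finset.mul_sum, sub_sub, ← Finset.sum_add_distrib]
        congr 1
        refine Finset.sum_congr rfl fun i _ => ?_
        rw [map_add, map_mul, map_pow]
        ring
      rw [e1, map_mul, map_pow, nm_algebraMap, pow_succ]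
      exact mul_le_mul_of_nonneg_left hxg (pow_nonneg (nm_nonneg p _) _)

end Extension

/-! ### Integers as polynomials in a uniformizer -/

section FiniteExtension

variable {p : ℕ} [Fact p.Prime]
variable {F M : Type*} [Field F] [Field M] [Algebra F M] [Algebra ℚ_[p] F] [Algebra ℚ_[p] M]
  [IsScalarTower ℚ_[p] F M] [FiniteDimensional ℚ_[p] F] [FiniteDimensional ℚ_[p] M]

/-- The integral coefficient vectors form a compact set, so the set of their values is closed; by
`exists_approx_pow` it contains `x` in its closure. -/
lemma IsTotallyRamified.exists_expansion (hTR : IsTotallyRamified p F M) {πF : F}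
    (hF : IsUnif p πF) {π : M} (hπ : IsUnif p π) {e : ℕ} (he : nm p F πF = nm p M π ^ e)
    {x : M} (hx : nm p M x ≤ 1) : ∃ a : Fin e → F, (∀ i, nm p F (a i) ≤ 1) ∧
      x = ∑ i, algebraMap F M (a i) * π ^ (i : ℕ) := by
  let _ := spectralNorm.normedField ℚ_[p] M
  let _ := spectralNorm.normedField ℚ_[p] F
  let _ : NormedSpace ℚ_[p] F := spectralNorm.normedSpace ℚ_[p] F
  have _ : ProperSpace F := FiniteDimensional.proper ℚ_[p] F
  have hcont : Continuous (algebraMap F M) :=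
    (AddMonoidHomClass.isometry_of_norm (algebraMap F M) fun x => nm_algebraMap p x).continuous
  have hcomp : IsCompact (Set.univ.pi fun _ : Fin e => Metric.closedBall (0 : F) 1) :=
    isCompact_univ_pi fun _ => isCompact_closedBall _ _
  have hf : Continuous fun a : Fin e → F => ∑ i, algebraMap F M (a i) * π ^ (i : ℕ) := by
    fun_prop
  have hcl := (hcomp.image hf).isClosed
  have hmem : x ∈ closure ((fun a : Fin e → F => ∑ i, algebraMap F M (a i) * π ^ (i : ℕ)) ''
      (Set.univ.pi fun _ : Fin e => Metric.closedBall (0 : F) 1)) := by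
    rw [Metric.mem_closure_iff]
    intro ε hε
    obtain ⟨k, hk⟩ := exists_pow_lt_of_lt_one hε hF.lt_one
    obtain ⟨a, ha, hxa⟩ := hTR.exists_approx_pow hF hπ he hx k
    refine ⟨_, ⟨a, fun i _ => mem_closedBall_zero_iff.2 (ha i), rfl⟩, ?_⟩
    rw [dist_eq_norm]
    exact lt_of_le_of_lt hxa hk
  rw [hcl.closure_eq] at hmem
  obtain ⟨a, ha, rfl⟩ := hmem
  exact ⟨a, fun i => mem_closedBall_zero_iff.1 (ha i trivial), rfl⟩

lemma IsTotallyRamified.exists_aeval_eq (hTR : IsTotallyRamified p F M) {π : M}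
    (hπ : IsUnif p π) {x : M} (hx : nm p M x ≤ 1) :
    ∃ g : Polynomial F, (∀ i, nm p F (g.coeff i) ≤ 1) ∧ Polynomial.aeval π g = x := by
  obtain ⟨πF, hF⟩ := exists_isUnif p F
  obtain ⟨e, he⟩ := hF.exists_ramificationIndex hπ
  obtain ⟨a, ha, rfl⟩ := hTR.exists_expansion hF hπ he hx
  refine ⟨∑ i : Fin e, Polynomial.monomial (i : ℕ) (a i), fun j => ?_, ?_⟩
  · rw [Polynomial.finsetSum_coeff]
    refine nm_sum_le p _ _ zero_le_one fun i _ => ?_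
    rw [Polynomial.coeff_monomial]
    split_ifs
    · exact ha i
    · simp
  · simp [Polynomial.aeval_monomial]

/-- The degree is at most the ramification index `e` because `1, π, …, π^(e-1)` span `M` over `F`.
Conversely the norm of `π` lies in `F` and has absolute value `|π|^[M:F]`, which forces `e` to
divide the degree. -/
lemma IsTotallyRamified.nm_unif_eq [IsGalois F M] (hTR : IsTotallyRamified p F M) {πF : F}
    (hF : IsUnif p πF) {π : M} (hπ : IsUnif p π) :
    nm p F πF = nm p M π ^ Nat.card Gal(M/F) := by
  have _ : FiniteDimensional F M := FiniteDimensional.right ℚ_[p] F M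
  obtain ⟨e, he⟩ := hF.exists_ramificationIndex hπ
  suffices h : Nat.card Gal(M/F) = e by rw [h, he]
  have hle : Module.finrank F M ≤ e := by
    let f : (Fin e → F) →ₗ[F] M := ∑ i : Fin e, (LinearMap.proj i).smulRight (π ^ (i : ℕ))
    have hs : Function.Surjective f := by
      intro x
      obtain ⟨k, hk⟩ : ∃ k : ℕ, nm p M (algebraMap F M πF ^ k * x) ≤ 1 := by
        obtain ⟨k, hk⟩ := exists_pow_lt_of_lt_one
          (inv_pos.2 (show 0 < nm p M x + 1 by linarith [nm_nonneg p x])) hF.lt_one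
        refine ⟨k, ?_⟩
        rw [map_mul, map_pow, nm_algebraMap]
        rw [lt_inv_comm₀ (pow_pos hF.pos _) (by linarith [nm_nonneg p x])] at hk
        have h0 := pow_pos hF.pos k
        calc _ ≤ nm p F πF ^ k * (nm p F πF ^ k)⁻¹ := by gcongr; linarith
          _ = 1 := mul_inv_cancel₀ h0.ne'
      obtain ⟨a, -, ha⟩ := hTR.exists_expansion hF hπ he hk
      have h0 : algebraMap F M πF ^ k ≠ 0 := pow_ne_zero _ ((map_ne_zero _).2 hF.ne_zero)
      refine ⟨(πF ^ k)⁻¹ • a, ?_⟩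
      rw [map_smul]
      have : f a = algebraMap F M πF ^ k * x := by
        rw [ha]; simp [f, Algebra.smul_def]
      rw [this, Algebra.smul_def, map_inv₀, map_pow, inv_mul_cancel_left₀ h0]
    simpa using LinearMap.finrank_le_finrank_of_surjective hs
  rw [IsGalois.card_aut_eq_finrank]
  refine le_antisymm hle ?_
  have hN := congrArg (nm p M) (Algebra.norm_eq_prod_automorphisms F π)
  rw [map_prod, nm_algebraMap] at hN
  simp only [nm_aut, Finset.prod_const, Finset.card_univ] at hN
  rw [← Nat.card_eq_fintype_card, IsGalois.card_aut_eq_finrank] at hN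
  have hne : Algebra.norm F π ≠ 0 := Algebra.norm_ne_zero_iff.2 hπ.ne_zero
  obtain ⟨k, hk⟩ := hF.exists_zpow hne
  rw [hk, he, ← zpow_natCast, ← zpow_natCast, ← zpow_mul] at hN
  have hek : (e : ℤ) * k = Module.finrank F M :=
    zpow_right_injective₀ hπ.pos hπ.lt_one.ne hN
  have hpos : 0 < Module.finrank F M := Module.finrank_pos
  have : (e : ℤ) ∣ (Module.finrank F M : ℤ) := ⟨k, hek.symm⟩
  exact Nat.le_of_dvd hpos (Int.natCast_dvd_natCast.1 this)

/-- Write `x = g(π)` with `g` integral over `F`; such a polynomial does not increase distances in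
the unit ball. Hence the displacement of `π` alone decides membership in every lower ramification
group. -/
lemma IsTotallyRamified.nm_sub_le (hTR : IsTotallyRamified p F M) {π : M} (hπ : IsUnif p π)
    (σ : Gal(M/F)) {x : M} (hx : nm p M x ≤ 1) :
    nm p M (σ x - x) ≤ nm p M (σ π - π) := by
  obtain ⟨g, hg, rfl⟩ := hTR.exists_aeval_eq hπ hx
  have : σ (Polynomial.aeval π g) = Polynomial.aeval (σ π) g :=
    (Polynomial.aeval_algHom_apply (σ : M →ₐ[F] M) π g).symm
  rw [this]
  exact nm_aeval_sub_le p hg (by rw [nm_aut]; exact hπ.lt_one.le) hπ.lt_one.le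

lemma IsTotallyRamified.mem_lowerRam_iff (hTR : IsTotallyRamified p F M) {π : M}
    (hπ : IsUnif p π) (σ : Gal(M/F)) (s : ℝ) :
    σ ∈ lowerRam p F M s ↔ nm p M (σ π - π) ≤ nm p M π ^ (⌈s⌉₊ + 1) := by
  have hO : π ∈ ringOfInt p M := (mem_ringOfInt_iff p π).2 hπ.lt_one.le
  constructor
  · intro h
    obtain ⟨y, hy, e⟩ := h ⟨π, hO⟩
    rw [← e]
    exact (hπ.mem_maxIdeal_pow_iff _ y).1 hy
  · intro h x
    have hx := (mem_ringOfInt_iff p (x : M)).1 x.2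
    have hle := (hTR.nm_sub_le hπ σ hx).trans h
    refine ⟨⟨σ x - x, (mem_ringOfInt_iff p _).2 (hle.trans
      (pow_le_one₀ (nm_nonneg p _) hπ.lt_one.le))⟩, (hπ.mem_maxIdeal_pow_iff _ _).2 hle, rfl⟩

end FiniteExtension

/-! ### A product formula for the upper numbering -/

lemma integral_ite_le {b t : ℝ} (hb : 0 ≤ b) (ht : 0 ≤ t) :
    ∫ s in (0 : ℝ)..t, (if s ≤ b then (1 : ℝ) else 0) = min t b := by
  have e : (fun s : ℝ => if s ≤ b then (1 : ℝ) else 0) = (Set.Iic b).indicator fun _ => 1 := by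
    ext s; simp [Set.indicator_apply]
  rw [intervalIntegral.integral_of_le ht, e, MeasureTheory.setIntegral_indicator measurableSet_Iic,
    Set.Ioc_inter_Iic]
  simp [le_min ht hb]

lemma intervalIntegrable_ite_le (b t : ℝ) :
    IntervalIntegrable (fun s : ℝ => if s ≤ b then (1 : ℝ) else 0) MeasureTheory.volume 0 t := by
  refine Antitone.intervalIntegrable fun x y hxy => ?_
  split_ifs with h1 h2
  · exact le_rfl
  · exact absurd (hxy.trans h1) h2
  · exact zero_le_one
  · exact le_rfl

section UpperNumbering

variable (p : ℕ) [Fact p.Prime]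
variable {F M : Type*} [Field F] [Field M] [Algebra F M] [Algebra ℚ_[p] F] [Algebra ℚ_[p] M]
  [IsScalarTower ℚ_[p] F M] [FiniteDimensional ℚ_[p] F] [FiniteDimensional ℚ_[p] M]
  [FiniteDimensional F M]

/-- The product of `max |τ π - π| |σ π - π|` over all `τ ∈ Gal(M/F)`, which measures the position
of `σ` in the upper ramification filtration. -/
noncomputable def ramProd (π : M) (σ : Gal(M/F)) : ℝ :=
  ∏ τ : Gal(M/F), max (nm p M (τ π - π)) (nm p M (σ π - π))

variable {p} [IsGalois F M]

lemma IsTotallyRamified.lowerRam_zero (hTR : IsTotallyRamified p F M) :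
    lowerRam p F M 0 = ⊤ := by
  obtain ⟨π, hπ⟩ := exists_isUnif p M
  refine eq_top_iff.2 fun σ _ => (hTR.mem_lowerRam_iff hπ σ 0).2 ?_
  simpa using nm_sub_le_of_le p (nm_aut p σ π).le le_rfl

lemma aut_unif_ne (hTR : IsTotallyRamified p F M) {π : M} (hπ : IsUnif p π) {σ : Gal(M/F)}
    (hσ : σ ≠ 1) : σ π - π ≠ 0 := by
  intro h0
  apply hσ
  have key : ∀ x : M, nm p M x ≤ 1 → σ x = x := by
    intro x hx
    have := hTR.nm_sub_le hπ σ hx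
    rw [h0, map_zero] at this
    exact sub_eq_zero.1 ((map_eq_zero _).1 (le_antisymm this (nm_nonneg p _)))
  ext x
  rcases le_or_gt (nm p M x) 1 with h | h
  · exact key x h
  · have := key x⁻¹ (by rw [map_inv₀]; exact inv_le_one_of_one_le₀ h.le)
    rw [map_inv₀] at this
    exact inv_injective this

/-- The lower breaks of the automorphisms `σ ≠ 1`. -/
lemma IsTotallyRamified.exists_lowerBreak (hTR : IsTotallyRamified p F M) {π : M}
    (hπ : IsUnif p π) : ∃ b : Gal(M/F) → ℕ,
      ∀ σ, σ ≠ 1 → nm p M (σ π - π) = nm p M π ^ (b σ + 1) := by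
  have : ∀ σ : Gal(M/F), ∃ b : ℕ, σ ≠ 1 → nm p M (σ π - π) = nm p M π ^ (b + 1) := by
    intro σ
    by_cases hσ : σ = 1
    · exact ⟨0, fun h => absurd hσ h⟩
    obtain ⟨k, hk⟩ := hπ.exists_zpow (aut_unif_ne hTR hπ hσ)
    have h1 : nm p M (σ π - π) ≤ nm p M π := nm_sub_le_of_le p (nm_aut p σ π).le le_rfl
    have h2 : 1 ≤ k := by
      rw [hk] at h1
      have h1 : nm p M π ^ k ≤ nm p M π ^ (1 : ℤ) := by simpa using h1
      exact hπ.zpow_le_iff.1 h1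
    obtain ⟨m, rfl⟩ : ∃ m : ℕ, k = m + 1 := ⟨(k - 1).toNat, by omega⟩
    exact ⟨m, fun _ => by rw [hk]; norm_cast⟩
  choose b hb using this
  exact ⟨b, hb⟩

lemma mem_lowerRam_iff_le (hTR : IsTotallyRamified p F M) {π : M} (hπ : IsUnif p π)
    {b : Gal(M/F) → ℕ} (hb : ∀ σ, σ ≠ 1 → nm p M (σ π - π) = nm p M π ^ (b σ + 1))
    {σ : Gal(M/F)} (hσ : σ ≠ 1) (s : ℝ) : σ ∈ lowerRam p F M s ↔ s ≤ b σ := by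
  rw [hTR.mem_lowerRam_iff hπ, hb σ hσ, pow_le_pow_iff_right_of_lt_one₀ hπ.pos hπ.lt_one,
    Nat.add_le_add_iff_right, Nat.ceil_le]

open Classical in
-- The order of `G_s` counts the `σ` with `s ≤ b σ`, so sum and integral can be exchanged. The
-- identity has infinite break and contributes `t`.
lemma herbrandPhi_eq (hTR : IsTotallyRamified p F M) {π : M} (hπ : IsUnif p π)
    {b : Gal(M/F) → ℕ} (hb : ∀ σ, σ ≠ 1 → nm p M (σ π - π) = nm p M π ^ (b σ + 1))
    {t : ℝ} (ht : 0 ≤ t) : herbrandPhi p F M t =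
      (∑ σ : Gal(M/F), if σ = 1 then t else min t (b σ)) / Nat.card Gal(M/F) := by
  have hcard : ∀ s : ℝ, (Nat.card (lowerRam p F M s) : ℝ) =
      ∑ σ : Gal(M/F), if σ = 1 then 1 else if s ≤ b σ then (1 : ℝ) else 0 := by
    intro s
    have hc : Nat.card (lowerRam p F M s) =
        (Finset.univ.filter fun σ => σ ∈ lowerRam p F M s).card :=
      Nat.subtype_card _ (by simp)
    rw [hc, Finset.card_filter, Nat.cast_sum]
    refine Finset.sum_congr rfl fun σ _ => ?_
    by_cases hσ : σ = 1
    · simp [hσ, one_mem]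
    · simp [hσ, mem_lowerRam_iff_le hTR hπ hb hσ]
  rw [herbrandPhi]
  simp_rw [hTR.lowerRam_zero, hcard, Subgroup.card_top]
  rw [intervalIntegral.integral_div, intervalIntegral.integral_finsetSum]
  · congr 1
    refine Finset.sum_congr rfl fun σ _ => ?_
    by_cases hσ : σ = 1
    · simp [hσ]
    · simp only [hσ, if_false]
      exact integral_ite_le (Nat.cast_nonneg _) ht
  · intro σ _
    by_cases hσ : σ = 1
    · simp [hσ]
    · simp only [hσ, if_false]
      exact intervalIntegrable_ite_le _ _

/-- The infimum defining `herbrand` is attained, because `φ` is continuous and unbounded;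
monotonicity of `φ` then gives the equivalence. -/
lemma herbrand_le_iff (hTR : IsTotallyRamified p F M) {u t : ℝ} (hu : 0 ≤ u) (ht : 0 ≤ t) :
    herbrand p F M u ≤ t ↔ u ≤ herbrandPhi p F M t := by
  classical
  obtain ⟨π, hπ⟩ := exists_isUnif p M
  obtain ⟨b, hb⟩ := hTR.exists_lowerBreak hπ
  have hn : (0 : ℝ) < Nat.card Gal(M/F) := by exact_mod_cast Nat.card_pos
  have hmono : ∀ s t : ℝ, 0 ≤ s → s ≤ t → herbrandPhi p F M s ≤ herbrandPhi p F M t := by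
    intro s t hs hst
    rw [herbrandPhi_eq hTR hπ hb hs, herbrandPhi_eq hTR hπ hb (hs.trans hst)]
    gcongr with σ
    split_ifs
    · exact hst
    · gcongr
  have hS : {t : ℝ | 0 ≤ t ∧ u ≤ herbrandPhi p F M t} = {t : ℝ | 0 ≤ t} ∩ {t : ℝ | u ≤
      (∑ σ : Gal(M/F), if σ = 1 then t else min t (b σ)) / Nat.card Gal(M/F)} := by
    ext t
    simp only [Set.mem_ofPred_eq, Set.mem_inter_iff]
    refine and_congr_right fun h => ?_
    rw [herbrandPhi_eq hTR hπ hb h]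
  have hclosed : IsClosed {t : ℝ | 0 ≤ t ∧ u ≤ herbrandPhi p F M t} := by
    rw [hS]
    refine (isClosed_le continuous_const continuous_id).inter
      (isClosed_le continuous_const (Continuous.div_const ?_ _))
    refine continuous_finsetSum _ fun σ _ => ?_
    split_ifs <;> fun_prop
  have hne : {t : ℝ | 0 ≤ t ∧ u ≤ herbrandPhi p F M t}.Nonempty := by
    -- The identity alone contributes `t / |G|` to `φ(t)`.
    refine ⟨u * Nat.card Gal(M/F), mul_nonneg hu hn.le, ?_⟩
    rw [herbrandPhi_eq hTR hπ hb (mul_nonneg hu hn.le), le_div_iff₀ hn,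
      ← Finset.add_sum_erase _ _ (Finset.mem_univ (1 : Gal(M/F))), if_pos rfl]
    refine le_add_of_nonneg_right (Finset.sum_nonneg fun σ _ => ?_)
    split_ifs
    · exact mul_nonneg hu hn.le
    · exact le_min (mul_nonneg hu hn.le) (Nat.cast_nonneg _)
  have hbdd : BddBelow {t : ℝ | 0 ≤ t ∧ u ≤ herbrandPhi p F M t} := ⟨0, fun t h => h.1⟩
  constructor
  · intro h
    have hmem := hclosed.csInf_mem hne hbdd
    exact hmem.2.trans (hmono _ _ hmem.1 h)
  · intro h
    exact csInf_le hbdd ⟨ht, h⟩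

/-- For `σ ≠ 1`, membership means `u ≤ φ(b σ)`. To the base `|π|`, the exponent of the product is
the sum over `τ` of `min(b σ, b τ) + 1`, which is `|G| (φ(b σ) + 1)`; and `|π|^|G| = |πF|`. -/
theorem mem_upperRamFinite_iff (hTR : IsTotallyRamified p F M) {πF : F} (hF : IsUnif p πF)
    {π : M} (hπ : IsUnif p π) {u : ℝ} (hu : 0 ≤ u) (σ : Gal(M/F)) :
    σ ∈ upperRamFinite p F M u ↔ ramProd p π σ ≤ nm p F πF ^ (1 + u) := by
  classical
  by_cases hσ : σ = 1
  · subst hσ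
    refine iff_of_true (one_mem _) ?_
    rw [ramProd, Finset.prod_eq_zero (Finset.mem_univ (1 : Gal(M/F))) (by simp)]
    exact Real.rpow_nonneg (nm_nonneg p _) _
  obtain ⟨b, hb⟩ := hTR.exists_lowerBreak hπ
  have hn : (0 : ℝ) < Nat.card Gal(M/F) := by exact_mod_cast Nat.card_pos
  have hprod : ramProd p π σ =
      nm p M π ^ (∑ τ : Gal(M/F), if τ = 1 then (b σ : ℝ) + 1 else min (b σ : ℝ) (b τ) + 1) := by
    rw [Real.rpow_sum_of_pos hπ.pos, ramProd]
    refine Finset.prod_congr rfl fun τ _ => ?_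
    rw [hb σ hσ]
    split_ifs with h
    · rw [h]
      have : (0 : ℝ) ≤ nm p M π ^ (b σ + 1) := pow_nonneg (nm_nonneg p _) _
      simp only [AlgEquiv.one_apply, sub_self, map_zero, max_eq_right this]
      exact_mod_cast rfl
    · rw [hb τ h]
      rcases le_total (b σ) (b τ) with hle | hle
      · rw [min_eq_left (by exact_mod_cast hle), max_eq_right
          (pow_le_pow_of_le_one (nm_nonneg p _) hπ.lt_one.le (by omega))]
        exact_mod_cast rfl
      · rw [min_eq_right (by exact_mod_cast hle), max_eq_left
          (pow_le_pow_of_le_one (nm_nonneg p _) hπ.lt_one.le (by omega))]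
        exact_mod_cast rfl
  rw [hprod, hTR.nm_unif_eq hF hπ, ← Real.rpow_natCast, ← Real.rpow_mul (nm_nonneg p _),
    Real.rpow_le_rpow_left_iff_of_base_lt_one hπ.pos hπ.lt_one, upperRamFinite,
    mem_lowerRam_iff_le hTR hπ hb hσ, herbrand_le_iff hTR hu (Nat.cast_nonneg _),
    herbrandPhi_eq hTR hπ hb (Nat.cast_nonneg _), le_div_iff₀ hn]
  have : (∑ τ : Gal(M/F), if τ = 1 then (b σ : ℝ) + 1 else min (b σ : ℝ) (b τ) + 1) =
      (∑ τ : Gal(M/F), if τ = 1 then (b σ : ℝ) else min (b σ : ℝ) (b τ)) +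
        Nat.card Gal(M/F) := by
    rw [Nat.card_eq_fintype_card, ← Finset.card_univ, Finset.card_eq_sum_ones, Nat.cast_sum,
      ← Finset.sum_add_distrib]
    refine Finset.sum_congr rfl fun τ _ => ?_
    split_ifs <;> simp
  rw [this]
  constructor <;> intro h <;> linarith

end UpperNumbering

/-! ### Herbrand's theorem -/

section Herbrand

variable (p : ℕ) [Fact p.Prime]
variable {F M : Type*} [Field F] [Field M] [Algebra F M] [Algebra ℚ_[p] F] [Algebra ℚ_[p] M]
  [IsScalarTower ℚ_[p] F M] [FiniteDimensional ℚ_[p] F] [FiniteDimensional ℚ_[p] M]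
  [FiniteDimensional F M] [IsGalois F M]

lemma nm_mul_aut_le (π : M) (σ τ : Gal(M/F)) :
    nm p M ((σ * τ) π - π) ≤ max (nm p M (τ π - π)) (nm p M (σ π - π)) := by
  have e : (σ * τ) π - π = σ (τ π - π) + (σ π - π) := by
    rw [AlgEquiv.mul_apply, map_sub]; ring
  rw [e]
  refine (nm_add_le p _ _).trans_eq ?_
  rw [nm_aut]

lemma nm_inv_aut (π : M) (σ : Gal(M/F)) :
    nm p M (σ⁻¹ π - π) = nm p M (σ π - π) := by
  rw [← nm_aut p σ (σ⁻¹ π - π), map_sub, ← AlgEquiv.mul_apply, mul_inv_cancel,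
    AlgEquiv.one_apply, nm_sub_comm]

lemma ramProd_le_ramProd {π : M} {σ τ : Gal(M/F)}
    (h : nm p M (σ π - π) ≤ nm p M (τ π - π)) : ramProd p π σ ≤ ramProd p π τ :=
  Finset.prod_le_prod (fun _ _ => (nm_nonneg p _).trans (le_max_left _ _))
    fun _ _ => max_le_max le_rfl h

variable {M' : Type*} [Field M'] [Algebra F M'] [Algebra ℚ_[p] M'] [IsScalarTower ℚ_[p] F M']
  [FiniteDimensional ℚ_[p] M'] [FiniteDimensional F M'] [IsGalois F M']
  [Algebra M' M] [IsScalarTower F M' M] [IsScalarTower ℚ_[p] M' M]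

variable {p}

variable [FiniteDimensional M' M]

/-- The monic polynomial with integral coefficients and roots the conjugates of `π` over `M'`. -/
lemma exists_conjugate_polynomial [IsGalois M' M] {π : M} (hπ : IsUnif p π) :
    ∃ f : Polynomial (ringOfInt p M), f.Monic ∧
      f.map (ringOfInt p M).subtype =
        ∏ ν : Gal(M/M'), (Polynomial.X - Polynomial.C (ν π)) ∧
      ∀ i, ∃ c : M', nm p M' c ≤ 1 ∧ algebraMap M' M c = f.coeff i := by
  have hO : ∀ ν : Gal(M/M'), ν π ∈ ringOfInt p M := fun ν =>
    (mem_ringOfInt_iff p _).2 (by rw [nm_aut]; exact hπ.lt_one.le)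
  have hmap : (∏ ν : Gal(M/M'), (Polynomial.X - Polynomial.C
      (⟨ν π, hO ν⟩ : ringOfInt p M))).map (ringOfInt p M).subtype =
        ∏ ν : Gal(M/M'), (Polynomial.X - Polynomial.C (ν π)) := by
    rw [Polynomial.map_prod]
    refine Finset.prod_congr rfl fun ν _ => ?_
    simp
  refine ⟨_, Polynomial.monic_prod_of_monic _ _ fun ν _ => Polynomial.monic_X_sub_C _, hmap,
    fun i => ?_⟩
  set f := ∏ ν : Gal(M/M'), (Polynomial.X - Polynomial.C (⟨ν π, hO ν⟩ : ringOfInt p M))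
  have hfix : ((f.coeff i : ringOfInt p M) : M) ∈ Set.range (algebraMap M' M) := by
    rw [IsGalois.mem_range_algebraMap_iff_fixed]
    intro g
    have h1 : ((f.coeff i : ringOfInt p M) : M) = (f.map (ringOfInt p M).subtype).coeff i := by
      rw [Polynomial.coeff_map]; rfl
    rw [h1, hmap]
    change (g : M →+* M) _ = _
    rw [← Polynomial.coeff_map, Polynomial.map_prod]
    congr 1
    refine Fintype.prod_equiv (Equiv.mulLeft g) _ _ fun ν => ?_
    simp
  obtain ⟨c, hc⟩ := hfix
  refine ⟨c, ?_, hc⟩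
  rw [← nm_algebraMap p (M := M), hc]
  exact (mem_ringOfInt_iff p _).1 (Subtype.property _)

/-- Let `f` be the polynomial with roots the conjugates `νπ` of `π` over `M'`. Up to sign
conventions, which the absolute value ignores, the product is the value at `π` of the polynomial
`f^σ` obtained by applying `σ` to the coefficients. Both inequalities compare `f^σ(π)` with `σ'π' -
π'`. -/
lemma nm_sub_eq_prod (hTR : IsTotallyRamified p F M) {π : M} (hπ : IsUnif p π) {π' : M'}
    (hπ' : IsUnif p π') {σ : Gal(M/F)} {σ' : Gal(M'/F)}
    (hσ : ∀ x, σ (algebraMap M' M x) = algebraMap M' M (σ' x)) :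
    nm p M' (σ' π' - π') = ∏ ν : Gal(M/M'), nm p M (σ (ν π) - π) := by
  have hTR' : IsTotallyRamified p F M' := hTR.of_algHom (IsScalarTower.toAlgHom F M' M)
  have _ : IsGalois M' M := IsGalois.tower_top_of_isGalois F M' M
  obtain ⟨f, hmon, hmap, hcoeff⟩ := exists_conjugate_polynomial (M' := M') hπ
  have hπ1 := hπ.lt_one.le
  have hev : ∀ q : Polynomial (ringOfInt p M),
      nm p M (((q.map (ringOfInt p M).subtype).map (σ : M →+* M)).eval π) ≤ 1 := by
    intro q
    rw [Polynomial.eval_eq_sum_range]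
    refine nm_sum_le p _ _ zero_le_one fun i _ => ?_
    rw [map_mul, map_pow, Polynomial.coeff_map, Polynomial.coeff_map]
    refine mul_le_one₀ ?_ (pow_nonneg (nm_nonneg p _) _) (pow_le_one₀ (nm_nonneg p _) hπ1)
    exact (nm_aut p σ _).trans_le ((mem_ringOfInt_iff p _).1 (Subtype.property _))
  have hprod : nm p M (((f.map (ringOfInt p M).subtype).map (σ : M →+* M)).eval π) =
      ∏ ν : Gal(M/M'), nm p M (σ (ν π) - π) := by
    rw [hmap, Polynomial.map_prod, Polynomial.eval_prod, map_prod]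
    refine Finset.prod_congr rfl fun ν _ => ?_
    simp [nm_sub_comm p π]
  have hf0 : (f.map (ringOfInt p M).subtype).eval π = 0 := by
    rw [hmap, Polynomial.eval_prod]
    exact Finset.prod_eq_zero (Finset.mem_univ 1) (by simp)
  rw [← hprod]
  refine le_antisymm ?_ ?_
  -- Write `π' = g(π)` with `g` over `F`. Then `g - π'` vanishes at all `νπ`, so `f` divides it;
  -- applying `σ` to the coefficients and evaluating at `π` shows that `f^σ(π)` divides `π' - σ'π'`.
  · obtain ⟨g, hg, hgπ⟩ := hTR.exists_aeval_eq hπ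
      (x := algebraMap M' M π') (by rw [nm_algebraMap]; exact hπ'.lt_one.le)
    have hgO : g.map (algebraMap F M) ∈ Polynomial.lifts (ringOfInt p M).subtype := by
      rw [Polynomial.lifts_iff_coeff_lifts]
      intro n
      refine ⟨⟨algebraMap F M (g.coeff n), (mem_ringOfInt_iff p _).2 ?_⟩, ?_⟩
      · rw [nm_algebraMap]; exact hg n
      · rw [Polynomial.coeff_map]; rfl
    obtain ⟨gO, hgO⟩ := (Polynomial.mem_lifts _).1 hgO
    let y : ringOfInt p M := ⟨algebraMap M' M π', (mem_ringOfInt_iff p _).2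
      (by rw [nm_algebraMap]; exact hπ'.lt_one.le)⟩
    have hdvd : f ∣ gO - Polynomial.C y := by
      rw [← Polynomial.map_dvd_map _ (ringOfInt p M).subtype_injective hmon, hmap]
      refine Finset.prod_dvd_of_coprime ?_ ?_
      · intro ν _ μ _ hne
        refine Polynomial.pairwise_coprime_X_sub_C (s := fun ν : Gal(M/M') => ν π) ?_ hne
        intro ν μ h
        have h1 : ((ν⁻¹ * μ : Gal(M/M')).restrictScalars F) π - π = 0 := by
          change ν⁻¹ (μ π) - π = 0
          rw [← show ν π = μ π from h, ← AlgEquiv.mul_apply, inv_mul_cancel, AlgEquiv.one_apply,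
            sub_self]
        by_contra hne
        refine aut_unif_ne hTR hπ (fun h2 => hne ?_) h1
        have h3 : ν⁻¹ * μ = 1 := by
          ext x; exact DFunLike.congr_fun h2 x
        rw [inv_mul_eq_one] at h3
        exact h3
      · intro ν _
        rw [Polynomial.dvd_iff_isRoot, Polynomial.map_sub, hgO, Polynomial.IsRoot.def,
          Polynomial.eval_sub, Polynomial.eval_map_algebraMap]
        have : Polynomial.aeval (ν π) g = ν (Polynomial.aeval π g) :=
          Polynomial.aeval_algHom_apply ((ν.restrictScalars F : Gal(M/F)) : M →ₐ[F] M) π g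
        rw [this, hgπ, AlgEquiv.commutes]
        simp [y]
    obtain ⟨q, hq⟩ := hdvd
    have h1 := congrArg (fun r : Polynomial (ringOfInt p M) =>
      nm p M (((r.map (ringOfInt p M).subtype).map (σ : M →+* M)).eval π)) hq
    simp only [Polynomial.map_mul, Polynomial.eval_mul, map_mul, Polynomial.map_sub,
      Polynomial.eval_sub, Polynomial.map_C, Polynomial.eval_C, hgO] at h1
    have h2 : ((g.map (algebraMap F M)).map (σ : M →+* M)).eval π = algebraMap M' M π' := by
      rw [Polynomial.map_map, ← hgπ, Polynomial.aeval_def, Polynomial.eval_map]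
      congr 1
      ext x
      exact AlgEquiv.commutes σ x
    have h3 : (σ : M →+* M) ((ringOfInt p M).subtype y) = algebraMap M' M (σ' π') := hσ π'
    rw [h2, h3, ← map_sub, nm_algebraMap, nm_sub_comm] at h1
    rw [h1]
    exact mul_le_of_le_one_right (nm_nonneg p _) (hev q)
  -- As `f(π) = 0`, the value is that of `f^σ - f`, whose coefficients are displacements of integers
  -- of `M'`, each bounded by `|σ'π' - π'|`.
  · have e : ((f.map (ringOfInt p M).subtype).map (σ : M →+* M)).eval π =
        ((f.map (ringOfInt p M).subtype).map (σ : M →+* M) -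
          f.map (ringOfInt p M).subtype).eval π := by
      rw [Polynomial.eval_sub, hf0, sub_zero]
    rw [e, Polynomial.eval_eq_sum_range]
    refine nm_sum_le p _ _ (nm_nonneg p _) fun i _ => ?_
    rw [map_mul, map_pow, Polynomial.coeff_sub, Polynomial.coeff_map, Polynomial.coeff_map]
    refine (mul_le_of_le_one_right (nm_nonneg p _) (pow_le_one₀ (nm_nonneg p _) hπ1)).trans ?_
    obtain ⟨c, hc1, hc⟩ := hcoeff i
    change nm p M (σ ((f.coeff i : ringOfInt p M) : M) - ((f.coeff i : ringOfInt p M) : M)) ≤ _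
    rw [← hc, hσ, ← map_sub, nm_algebraMap]
    exact hTR'.nm_sub_le hπ' σ' hc1

lemma exists_optimal_lift (π : M) (σ' : Gal(M'/F)) :
    ∃ σ : Gal(M/F), (∀ x, σ (algebraMap M' M x) = algebraMap M' M (σ' x)) ∧
      ∀ τ : Gal(M/F), (∀ x, τ (algebraMap M' M x) = algebraMap M' M (σ' x)) →
        nm p M (σ π - π) ≤ nm p M (τ π - π) := by
  obtain ⟨σ₀, hσ₀⟩ := AlgEquiv.restrictNormalHom_surjective (F := F) (K₁ := M') M σ'
  have hne : {σ : Gal(M/F) | ∀ x, σ (algebraMap M' M x) = algebraMap M' M (σ' x)}.Nonempty :=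
    ⟨σ₀, fun x => by rw [← hσ₀]; exact (AlgEquiv.restrictNormal_commutes σ₀ M' x).symm⟩
  obtain ⟨σ, hσ, hmin⟩ := (Set.toFinite _).exists_minimalFor (fun σ : Gal(M/F) => nm p M (σ π - π)) _ hne
  refine ⟨σ, hσ, fun τ hτ => ?_⟩
  rcases le_total (nm p M (σ π - π)) (nm p M (τ π - π)) with h | h
  · exact h
  · exact hmin hτ h

/-- The product `σν` is another lift of `σ'`, so it moves `π` at least as far as the optimal `σ`;
writing `ν = σ⁻¹(σν)` then bounds the displacement by `ν` too, so the ultrametric inequality is an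
equality. -/
lemma nm_optimal_mul {π : M} {σ' : Gal(M'/F)} {σ : Gal(M/F)}
    (hσ : ∀ x, σ (algebraMap M' M x) = algebraMap M' M (σ' x))
    (hmin : ∀ τ : Gal(M/F), (∀ x, τ (algebraMap M' M x) = algebraMap M' M (σ' x)) →
        nm p M (σ π - π) ≤ nm p M (τ π - π)) (ν : Gal(M/M')) :
    nm p M (σ (ν π) - π) = max (nm p M (ν π - π)) (nm p M (σ π - π)) := by
  refine le_antisymm (nm_mul_aut_le p π σ (ν.restrictScalars F)) ?_
  have h1 : nm p M (σ π - π) ≤ nm p M (σ (ν π) - π) :=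
    hmin (σ * ν.restrictScalars F) fun x => by
      change σ (ν (algebraMap M' M x)) = _
      rw [AlgEquiv.commutes, hσ]
  refine max_le ?_ h1
  have h2 := nm_mul_aut_le p π σ⁻¹ (σ * ν.restrictScalars F)
  rw [inv_mul_cancel_left, nm_inv_aut] at h2
  exact h2.trans (max_le le_rfl h1)

lemma prod_max_max {ι : Type*} (s : Finset ι) {f : ι → ℝ} (hf : ∀ i ∈ s, 0 ≤ f i) (a b : ℝ) :
    ∏ i ∈ s, max (f i) (max a b) = max (∏ i ∈ s, max (f i) a) (∏ i ∈ s, max (f i) b) := by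
  have key : ∀ a b : ℝ, a ≤ b → ∏ i ∈ s, max (f i) a ≤ ∏ i ∈ s, max (f i) b := fun a b h =>
    Finset.prod_le_prod (fun i hi => (hf i hi).trans (le_max_left _ _))
      fun i _ => max_le_max le_rfl h
  rcases le_total a b with h | h
  · rw [max_eq_right h, max_eq_right (key _ _ h)]
  · rw [max_eq_left h, max_eq_left (key _ _ h)]

/-- Split `Gal(M/F)` into cosets of `Gal(M/M')` represented by optimal lifts. By `nm_optimal_mul`,
`prod_max_max` and `nm_sub_eq_prod`, the factors over the coset of `τ'` multiply to `max(|τ'π'-π'|,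
|σ'π'-π'|)`. -/
lemma ramProd_optimal (hTR : IsTotallyRamified p F M) {π : M} (hπ : IsUnif p π) {π' : M'}
    (hπ' : IsUnif p π') {σ' : Gal(M'/F)} {σ : Gal(M/F)}
    (hσ : ∀ x, σ (algebraMap M' M x) = algebraMap M' M (σ' x))
    (hmin : ∀ τ : Gal(M/F), (∀ x, τ (algebraMap M' M x) = algebraMap M' M (σ' x)) →
        nm p M (σ π - π) ≤ nm p M (τ π - π)) :
    ramProd p π σ = ramProd p π' σ' := by
  choose l hl hlmin using exists_optimal_lift (p := p) (F := F) (M' := M') π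
  have hval : ∀ (τ : Gal(M/F)) (τ' : Gal(M'/F)),
      (∀ x, τ (algebraMap M' M x) = algebraMap M' M (τ' x)) →
      (∀ ρ : Gal(M/F), (∀ x, ρ (algebraMap M' M x) = algebraMap M' M (τ' x)) →
        nm p M (τ π - π) ≤ nm p M (ρ π - π)) →
      nm p M' (τ' π' - π') = ∏ ν : Gal(M/M'), max (nm p M (ν π - π)) (nm p M (τ π - π)) := by
    intro τ τ' h1 h2
    rw [nm_sub_eq_prod hTR hπ hπ' h1]
    exact Finset.prod_congr rfl fun ν _ => nm_optimal_mul h1 h2 ν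
  have hbij : Function.Bijective
      fun x : Gal(M'/F) × Gal(M/M') => l x.1 * x.2.restrictScalars F := by
    constructor
    · rintro ⟨τ, ν⟩ ⟨τ', ν'⟩ h
      have h : l τ * ν.restrictScalars F = l τ' * ν'.restrictScalars F := h
      have e : τ = τ' := by
        ext x
        apply FaithfulSMul.algebraMap_injective M' M
        have := DFunLike.congr_fun h (algebraMap M' M x)
        change l τ (ν (algebraMap M' M x)) = l τ' (ν' (algebraMap M' M x)) at this
        rwa [AlgEquiv.commutes, AlgEquiv.commutes, hl, hl] at this
      subst e
      have h' := mul_left_cancel h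
      congr 1
      ext x
      exact DFunLike.congr_fun h' x
    · intro τ
      have hτ : ∀ x, τ (algebraMap M' M x) = algebraMap M' M (τ.restrictNormal M' x) := fun x =>
        (AlgEquiv.restrictNormal_commutes τ M' x).symm
      refine ⟨⟨τ.restrictNormal M', AlgEquiv.ofRingEquiv
        (f := (((l (τ.restrictNormal M'))⁻¹ * τ : Gal(M/F)) : M ≃+* M)) fun x => ?_⟩, ?_⟩
      · change (l (τ.restrictNormal M'))⁻¹ (τ (algebraMap M' M x)) = _
        rw [hτ, ← hl, ← AlgEquiv.mul_apply, inv_mul_cancel, AlgEquiv.one_apply]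
      · ext x
        change l (τ.restrictNormal M') ((l (τ.restrictNormal M'))⁻¹ (τ x)) = τ x
        rw [← AlgEquiv.mul_apply, mul_inv_cancel, AlgEquiv.one_apply]
  rw [ramProd, ← hbij.prod_comp, Fintype.prod_prod_type, ramProd]
  refine Finset.prod_congr rfl fun τ' _ => ?_
  rw [hval _ _ (hl τ') (hlmin τ'), hval _ _ hσ hmin,
    ← prod_max_max _ fun ν _ => nm_nonneg p _]
  refine Finset.prod_congr rfl fun ν _ => ?_
  change max (nm p M (l τ' (ν π) - π)) _ = _
  rw [nm_optimal_mul (hl τ') (hlmin τ'), max_assoc]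

end Herbrand

/-! ### Quotients and change of base field at finite level -/

section HerbrandTheorem

variable {p : ℕ} [Fact p.Prime]
variable {F M M' : Type*} [Field F] [Field M] [Algebra F M] [Algebra ℚ_[p] F] [Algebra ℚ_[p] M]
  [IsScalarTower ℚ_[p] F M] [FiniteDimensional ℚ_[p] F]
  [FiniteDimensional F M] [IsGalois F M] [Field M'] [Algebra F M'] [Algebra ℚ_[p] M']
  [IsScalarTower ℚ_[p] F M'] [FiniteDimensional F M'] [IsGalois F M']

/-- Herbrand's theorem: the upper numbering is compatible with quotients. -/
theorem upperRamFinite_quotient (hTR : IsTotallyRamified p F M) (i : M' →ₐ[F] M) {u : ℝ}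
    (hu : 0 ≤ u) (σ' : Gal(M'/F)) : σ' ∈ upperRamFinite p F M' u ↔
      ∃ σ ∈ upperRamFinite p F M u, ∀ x, σ (i x) = i (σ' x) := by
  let _ : Algebra M' M := i.toRingHom.toAlgebra
  have _ : IsScalarTower F M' M := IsScalarTower.of_algebraMap_eq fun x => (i.commutes x).symm
  have _ : IsScalarTower ℚ_[p] M' M := IsScalarTower.of_algebraMap_eq fun x =>
    ((i.restrictScalars ℚ_[p]).commutes x).symm
  have _ : FiniteDimensional M' M := FiniteDimensional.right F M' M
  have _ : FiniteDimensional ℚ_[p] M := FiniteDimensional.trans ℚ_[p] F M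
  have _ : FiniteDimensional ℚ_[p] M' := FiniteDimensional.trans ℚ_[p] F M'
  obtain ⟨π, hπ⟩ := exists_isUnif p M
  obtain ⟨π', hπ'⟩ := exists_isUnif p M'
  obtain ⟨πF, hF⟩ := exists_isUnif p F
  obtain ⟨σ₀, hσ₀, hmin⟩ := exists_optimal_lift (p := p) π σ'
  rw [mem_upperRamFinite_iff (hTR.of_algHom i) hF hπ' hu, ← ramProd_optimal hTR hπ hπ' hσ₀ hmin,
    ← mem_upperRamFinite_iff hTR hF hπ hu]
  refine ⟨fun h => ⟨σ₀, h, hσ₀⟩, ?_⟩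
  rintro ⟨σ, hσ, hσi⟩
  rw [mem_upperRamFinite_iff hTR hF hπ hu] at hσ ⊢
  exact (ramProd_le_ramProd p (hmin σ hσi)).trans hσ

/-- Passage from the base field `F` to a subfield `K`. -/
theorem restrictScalars_mem_upperRamFinite {K : Type*} [Field K] [Algebra K F] [Algebra K M]
    [IsScalarTower K F M] [Algebra ℚ_[p] K] [IsScalarTower ℚ_[p] K M] [IsScalarTower ℚ_[p] K F]
    [FiniteDimensional ℚ_[p] K] [FiniteDimensional K M] [IsGalois K M]
    (hTR : IsTotallyRamified p K M) (hTR' : IsTotallyRamified p F M) {πK : K} (hK : IsUnif p πK)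
    {πF : F} (hF : IsUnif p πF) {e : ℕ} (he : nm p K πK = nm p F πF ^ e) {x y : ℝ} (hx : 0 ≤ x)
    (hy : 0 ≤ y) (hxy : (e : ℝ) * (1 + x) = 1 + y) {σ : Gal(M/F)}
    (hσ : σ ∈ upperRamFinite p F M y) : σ.restrictScalars K ∈ upperRamFinite p K M x := by
  classical
  have _ : FiniteDimensional ℚ_[p] M := FiniteDimensional.trans ℚ_[p] F M
  obtain ⟨π, hπ⟩ := exists_isUnif p M
  rw [mem_upperRamFinite_iff hTR' hF hπ hy, ← hxy] at hσ
  rw [mem_upperRamFinite_iff hTR hK hπ hx, he, ← Real.rpow_natCast,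
    ← Real.rpow_mul (nm_nonneg p _)]
  refine le_trans ?_ hσ
  have hinj : Function.Injective fun τ : Gal(M/F) => τ.restrictScalars K := fun τ τ' h => by
    ext z; exact DFunLike.congr_fun h z
  have hle : ∀ τ : Gal(M/K), nm p M (τ π - π) ≤ 1 := fun τ =>
    nm_sub_le_of_le p ((nm_aut p τ π).trans_le hπ.lt_one.le) hπ.lt_one.le
  -- The product for `K` has the factors of the product for `F` and additional ones, each at most 1.
  have hsub := Finset.prod_sdiff (Finset.subset_univ
    (Finset.univ.image fun τ : Gal(M/F) => τ.restrictScalars K))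
    (f := fun τ : Gal(M/K) => max (nm p M (τ π - π)) (nm p M (σ.restrictScalars K π - π)))
  rw [Finset.prod_image hinj.injOn] at hsub
  rw [ramProd, ← hsub]
  refine mul_le_of_le_one_left (Finset.prod_nonneg fun τ _ =>
    (nm_nonneg p _).trans (le_max_left _ _)) (Finset.prod_le_one (fun τ _ =>
    (nm_nonneg p _).trans (le_max_left _ _)) fun τ _ => max_le (hle _) (hle _))

end HerbrandTheorem

/-! ### Cyclic extensions with bounded ramification -/

section Cyclic

variable {p : ℕ} [Fact p.Prime]
variable {F M : Type*} [Field F] [Field M] [Algebra F M] [Algebra ℚ_[p] F] [Algebra ℚ_[p] M]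
  [IsScalarTower ℚ_[p] F M] [FiniteDimensional ℚ_[p] F] [FiniteDimensional ℚ_[p] M]
  [FiniteDimensional F M] [IsGalois F M]

lemma nm_zpow_sub_one_le {u : M} (hu : nm p M u = 1) (k : ℤ) :
    nm p M (u ^ k - 1) ≤ nm p M (u - 1) := by
  have key : ∀ n : ℕ, nm p M (u ^ n - 1) ≤ nm p M (u - 1) := fun n => by
    simpa using nm_pow_sub_pow_le p (a := u) (b := 1) hu.le (by simp) n
  obtain ⟨n, rfl | rfl⟩ := k.eq_nat_or_neg
  · simpa using key n
  · have hu0 : u ^ n ≠ 0 := pow_ne_zero _ fun h => by simp [h] at hu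
    have e : u ^ (-(n : ℤ)) - 1 = (u ^ n)⁻¹ * -(u ^ n - 1) := by
      rw [zpow_neg, zpow_natCast]
      field_simp
      ring
    rw [e, map_mul, nm_neg, map_inv₀, map_pow, hu, one_pow, inv_one, one_mul]
    exact key n

/-- An automorphism moves every element at least as much as a uniformizer, relatively. -/
lemma nm_aut_sub_le (hTR : IsTotallyRamified p F M) {π : M} (hπ : IsUnif p π) (σ : Gal(M/F))
    (x : M) : nm p M (σ x - x) ≤ nm p M (σ π - π) / nm p M π * nm p M x := by
  by_cases hx : x = 0
  · simp [hx]
  obtain ⟨k, hk⟩ := hπ.exists_zpow hx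
  have hπ0 := hπ.ne_zero
  have hu : nm p M (σ π / π) = 1 := by rw [map_div₀, nm_aut, div_self hπ.pos.ne']
  have hu1 : nm p M (σ π / π - 1) = nm p M (σ π - π) / nm p M π := by
    rw [← map_div₀]; congr 1; field_simp
  set v := x / π ^ k with hv
  have hv1 : nm p M v = 1 := by
    rw [hv, map_div₀, map_zpow₀, hk, div_self (zpow_pos hπ.pos _).ne']
  have hxv : x = π ^ k * v := by rw [hv]; field_simp
  have e : σ x - x = σ π ^ k * (σ v - v) + ((σ π / π) ^ k - 1) * π ^ k * v := by
    have : (σ π / π) ^ k * π ^ k = σ π ^ k := by rw [← mul_zpow, div_mul_cancel₀ _ hπ0]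
    rw [hxv, map_mul, map_zpow₀, sub_mul, this]
    ring
  rw [e]
  refine nm_add_le_of_le p ?_ ?_
  · rw [map_mul, map_zpow₀, nm_aut, ← hk, mul_comm]
    refine mul_le_mul_of_nonneg_right ?_ (nm_nonneg p _)
    refine (hTR.nm_sub_le hπ σ hv1.le).trans ?_
    rw [le_div_iff₀ hπ.pos]
    exact mul_le_of_le_one_right (nm_nonneg p _) hπ.lt_one.le
  · rw [map_mul, map_mul, map_zpow₀, ← hk, hv1, mul_one, ← hu1]
    exact mul_le_mul_of_nonneg_right (nm_zpow_sub_one_le hu k) (nm_nonneg p _)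

/-- Frobenius is injective on the residue field: `(a - 1)^p` and `a^p - 1` differ by a multiple of
`p`. -/
lemma nm_sub_one_lt_of_pow_prime {a : M} (ha : nm p M a ≤ 1) (h : nm p M (a ^ p - 1) < 1) :
    nm p M (a - 1) < 1 := by
  have hb : nm p M (a - 1) ≤ 1 := nm_sub_le_of_le p ha (by simp)
  obtain ⟨r, hr⟩ := exists_add_pow_prime_eq (R := ringOfInt p M) (Fact.out : p.Prime)
    ⟨a - 1, (mem_ringOfInt_iff p _).2 hb⟩ 1
  have hr' := congrArg (fun z : ringOfInt p M => (z : M)) hr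
  simp only [Subring.coe_add, Subring.coe_mul, Subring.coe_pow, Subring.coe_one, one_pow,
    sub_add_cancel, mul_one, Subring.coe_natCast] at hr'
  have e : (a - 1) ^ p = (a ^ p - 1) - p * ((a - 1) * r) := by rw [hr']; ring
  have hlt : nm p M ((a - 1) ^ p) < 1 := by
    rw [e]
    refine (nm_sub_le p _ _).trans_lt (max_lt h ?_)
    rw [map_mul]
    refine mul_lt_one_of_nonneg_of_lt_one_left (nm_nonneg p _) (nm_prime_lt_one p) ?_
    rw [map_mul]
    exact mul_le_one₀ hb (nm_nonneg p _) ((mem_ringOfInt_iff p _).1 r.2)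
  rw [map_pow] at hlt
  exact (pow_lt_one_iff_of_nonneg (nm_nonneg p _) (Fact.out : p.Prime).ne_zero).1 hlt

/-- Automorphisms of `p`-power order are wildly ramified. -/
lemma nm_aut_sub_div_le (hTR : IsTotallyRamified p F M) {π : M} (hπ : IsUnif p π)
    {σ : Gal(M/F)} {k : ℕ} (hσ : σ ^ p ^ k = 1) :
    nm p M (σ π - π) / nm p M π ≤ nm p M π := by
  have hπ0 := hπ.ne_zero
  have hu : nm p M (σ π / π) = 1 := by rw [map_div₀, nm_aut, div_self hπ.pos.ne']
  have hu1 : nm p M (σ π / π - 1) = nm p M (σ π - π) / nm p M π := by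
    rw [← map_div₀]; congr 1; field_simp
  rw [← hu1]
  refine hπ.le _ ?_
  -- As `σ` acts trivially on the residue field, the residue of `σ^j π / π` is multiplicative in
  -- `j`. So `σπ/π` reduces to a root of unity of `p`-power order, which is 1 in characteristic `p`.
  have hpow : ∀ j : ℕ, nm p M ((σ ^ j) π / π - (σ π / π) ^ j) < 1 := by
    intro j
    induction j with
    | zero => simp [hπ0]
    | succ j ih =>
      have hv : nm p M ((σ ^ j) π / π) ≤ 1 := by
        rw [map_div₀, nm_aut, div_self hπ.pos.ne']
      have e : (σ ^ (j + 1)) π / π - (σ π / π) ^ (j + 1) =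
          (σ ((σ ^ j) π / π) - (σ ^ j) π / π) * (σ π / π) +
            ((σ ^ j) π / π - (σ π / π) ^ j) * (σ π / π) := by
        have hσπ : σ π ≠ 0 := (map_ne_zero σ).2 hπ0
        rw [pow_succ' σ, AlgEquiv.mul_apply, map_div₀, ← add_mul, sub_add_sub_cancel, sub_mul,
          ← pow_succ, div_mul_div_cancel₀ hσπ]
      rw [e]
      refine nm_add_lt p ?_ ?_
      · rw [map_mul, hu, mul_one]
        refine (hTR.nm_sub_le hπ σ hv).trans_lt
          (lt_of_le_of_lt (nm_sub_le_of_le p (nm_aut p σ π).le le_rfl) hπ.lt_one)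
      · rw [map_mul, hu, mul_one]
        exact ih
  have h1 := hpow (p ^ k)
  rw [hσ, AlgEquiv.one_apply, div_self hπ0, nm_sub_comm] at h1
  clear hpow
  have hdesc : ∀ (m : ℕ) (a : M), nm p M a ≤ 1 → nm p M (a ^ p ^ m - 1) < 1 →
      nm p M (a - 1) < 1 := by
    intro m
    induction m with
    | zero => intro a _ h; simpa using h
    | succ m ih =>
      intro a ha h
      refine ih a ha (nm_sub_one_lt_of_pow_prime ?_ ?_)
      · rw [map_pow]; exact pow_le_one₀ (nm_nonneg p _) ha
      · rw [← pow_mul, ← pow_succ]; exact h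
  exact hdesc k _ hu.le h1

/-- With `σ = 1 + D`, the operator `D` scales absolute values by at most `r`, and `(1 + D)^p - 1 =
D^p + p D q(D)` for an integral polynomial `q`. -/
lemma nm_aut_pow_prime_le (hTR : IsTotallyRamified p F M) {π : M} (hπ : IsUnif p π)
    (σ : Gal(M/F)) {r : ℝ} (hr : r = nm p M (σ π - π) / nm p M π) :
    nm p M ((σ ^ p) π - π) / nm p M π ≤ max (r ^ p) (nm p M (p : M) * r) := by
  have hr0 : 0 ≤ r := hr ▸ div_nonneg (nm_nonneg p _) (nm_nonneg p _)
  have hr1 : r ≤ 1 := by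
    rw [hr, div_le_one hπ.pos]
    exact nm_sub_le_of_le p (nm_aut p σ π).le le_rfl
  let D : Module.End F M := (σ : M →ₐ[F] M).toLinearMap - 1
  have hD1 : ∀ x, nm p M (D x) ≤ r * nm p M x := fun x => hr ▸ nm_aut_sub_le hTR hπ σ x
  have hDk : ∀ (k : ℕ) (x : M), nm p M ((D ^ k) x) ≤ r ^ k * nm p M x := by
    intro k x
    induction k with
    | zero => simp
    | succ k ih =>
      rw [pow_succ', Module.End.mul_apply, pow_succ', mul_assoc]
      exact (hD1 _).trans (mul_le_mul_of_nonneg_left ih hr0)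
  have hσk : ∀ k : ℕ, ((D + 1) ^ k) π = (σ ^ k) π := by
    intro k
    induction k with
    | zero => simp
    | succ k ih =>
      rw [pow_succ', Module.End.mul_apply, ih, pow_succ', AlgEquiv.mul_apply]
      simp [D]
  -- The identity is taken in the commutative ring `ℤ[X]` and then evaluated at `D`.
  obtain ⟨q, hq⟩ := exists_add_pow_prime_eq (R := Polynomial ℤ) (Fact.out : p.Prime)
    Polynomial.X 1
  have hq' := congrArg (Polynomial.aeval D) hq
  simp only [map_add, map_mul, map_pow, Polynomial.aeval_X, map_one, one_pow, mul_one,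
    map_natCast] at hq'
  have hqn : ∀ x, nm p M ((Polynomial.aeval D q) x) ≤ nm p M x := by
    intro x
    rw [Polynomial.aeval_eq_sum_range, LinearMap.sum_apply]
    refine nm_sum_le p _ _ (nm_nonneg p _) fun i _ => ?_
    rw [LinearMap.smul_apply, zsmul_eq_mul, map_mul]
    have h1 : nm p M ((q.coeff i : ℤ) : M) ≤ 1 := by
      rw [← map_intCast (algebraMap ℚ_[p] M), nm_padic]
      exact Padic.norm_int_le_one _
    have h2 : nm p M ((D ^ i) x) ≤ nm p M x :=
      (hDk i x).trans (mul_le_of_le_one_left (nm_nonneg p _) (pow_le_one₀ hr0 hr1))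
    exact (mul_le_of_le_one_left (nm_nonneg p _) h1).trans h2
  have e : (σ ^ p) π - π = (D ^ p) π + p * D ((Polynomial.aeval D q) π) := by
    rw [← hσk p, hq']
    simp only [LinearMap.add_apply, Module.End.mul_apply, Module.End.one_apply,
      Module.End.natCast_apply, nsmul_eq_mul]
    ring
  rw [div_le_iff₀ hπ.pos, e]
  refine (nm_add_le p _ _).trans (max_le ?_ ?_)
  · exact (hDk p π).trans (mul_le_mul_of_nonneg_right (le_max_left _ _) (nm_nonneg p _))
  · refine le_trans ?_ (mul_le_mul_of_nonneg_right (le_max_right _ _) (nm_nonneg p _))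
    rw [map_mul, mul_assoc]
    exact mul_le_mul_of_nonneg_left ((hD1 _).trans
      (mul_le_mul_of_nonneg_left (hqn π) hr0)) (nm_nonneg p _)

lemma nm_pow_aut_le (π : M) (σ : Gal(M/F)) (k : ℕ) :
    nm p M ((σ ^ k) π - π) ≤ nm p M (σ π - π) := by
  induction k with
  | zero => simpa using nm_nonneg p _
  | succ k ih =>
    rw [pow_succ]
    exact (nm_mul_aut_le p π _ _).trans (max_le le_rfl ih)

/-- Powers of `σ^k` move `π` no further than `σ^k` does, so each of their factors shrinks exactly by
the ratio of the two displacements; the other factors do not grow. -/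
lemma ramProd_pow_le {π : M} {σ : Gal(M/F)} (hσ : σ π - π ≠ 0) (k : ℕ) :
    ramProd p π (σ ^ k) ≤ ramProd p π σ *
      (nm p M ((σ ^ k) π - π) / nm p M (σ π - π)) ^ orderOf (σ ^ k) := by
  classical
  have hpos := nm_pos p hσ
  set c := nm p M ((σ ^ k) π - π) / nm p M (σ π - π) with hc
  have hprod : ∏ τ : Gal(M/F), (if τ ∈ Subgroup.zpowers (σ ^ k) then c else 1) =
      c ^ orderOf (σ ^ k) := by
    rw [Finset.prod_ite, Finset.prod_const_one, mul_one, Finset.prod_const]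
    congr 1
    rw [← Nat.card_zpowers]
    exact (Nat.subtype_card _ (by simp)).symm
  rw [← hprod, ramProd, ramProd, ← Finset.prod_mul_distrib]
  refine Finset.prod_le_prod (fun _ _ => (nm_nonneg p _).trans (le_max_left _ _)) fun τ _ => ?_
  split_ifs with h
  · obtain ⟨m, rfl⟩ := mem_powers_iff_mem_zpowers.2 h
    have h1 : nm p M (((σ ^ k) ^ m) π - π) ≤ nm p M ((σ ^ k) π - π) := nm_pow_aut_le π _ m
    rw [max_eq_right h1, max_eq_right (h1.trans (nm_pow_aut_le π _ k)), hc,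
      mul_div_cancel₀ _ hpos.ne']
  · rw [mul_one]
    exact max_le_max le_rfl (nm_pow_aut_le π _ k)

/-- In a totally ramified cyclic extension of degree `p ^ n`, the upper breaks grow linearly. -/
theorem le_of_upperRamFinite_eq_bot (hTR : IsTotallyRamified p F M) {n j : ℕ}
    (hcard : Nat.card Gal(M/F) = p ^ n) [IsCyclic Gal(M/F)] {y : ℝ} (hy : 0 ≤ y)
    (hbot : upperRamFinite p F M y = ⊥) (hyj : 2 * y ≤ j) : n ≤ j := by
  by_contra! hjn
  obtain ⟨τ, hτ⟩ := IsCyclic.exists_generator (α := Gal(M/F))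
  have hord : orderOf τ = p ^ n := by rw [orderOf_eq_card_of_forall_mem_zpowers hτ, hcard]
  have hp := (Fact.out : p.Prime)
  have hordj : ∀ j ≤ n, orderOf (τ ^ p ^ j) = p ^ (n - j) := by
    intro j hj
    rw [orderOf_pow_of_dvd (pow_ne_zero _ hp.ne_zero) (hord ▸ pow_dvd_pow p hj), hord,
      Nat.pow_div hj hp.pos]
  obtain ⟨π, hπ⟩ := exists_isUnif p M
  obtain ⟨πF, hF⟩ := exists_isUnif p F
  have hθ := hTR.nm_unif_eq hF hπ
  rw [hcard] at hθ
  set θ := nm p F πF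
  have hθ0 : 0 < θ := hF.pos
  have hθ1 : θ < 1 := hF.lt_one
  have hpθ : nm p M (p : M) ≤ θ := by
    rw [← map_natCast (algebraMap F M), nm_algebraMap]
    exact hF.le _ (nm_prime_lt_one p)
  have hp0 := nm_nonneg p (M := M) (p : M)
  set r : ℕ → ℝ := fun j => nm p M ((τ ^ p ^ j) π - π) / nm p M π with hr
  have hr0 : ∀ j, 0 ≤ r j := fun j => div_nonneg (nm_nonneg p _) (nm_nonneg p _)
  have hr1 : ∀ j, r j ≤ 1 := fun j => by
    rw [hr]
    dsimp only
    rw [div_le_one hπ.pos]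
    exact nm_sub_le_of_le p (nm_aut p _ π).le le_rfl
  have hstep : ∀ j, r (j + 1) ≤ max (r j ^ p) (nm p M (p : M) * r j) := by
    intro j
    have := nm_aut_pow_prime_le hTR hπ (τ ^ p ^ j) (r := r j) rfl
    rwa [← pow_mul, ← pow_succ] at this
  -- It starts from wildness, `r 0 ≤ |π|`. In each step either `r (j+1) ≤ r j ^ p`, which preserves
  -- the bound, or `r (j+1) ≤ |p| ≤ θ`.
  have hA : ∀ j, j ≤ n → r j ^ p ^ (n - j) ≤ θ := by
    intro j
    induction j with
    | zero =>
      intro _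
      rw [hθ, Nat.sub_zero]
      refine pow_le_pow_left₀ (hr0 0) ?_ _
      have h1 : τ ^ p ^ n = 1 := hord ▸ pow_orderOf_eq_one τ
      simpa [hr] using nm_aut_sub_div_le hTR hπ h1
    | succ j ih =>
      intro hj
      have hm := hstep j
      have e : n - j = (n - (j + 1)) + 1 := by omega
      have ih := ih (by omega)
      rw [e, pow_succ', pow_mul] at ih
      rcases le_max_iff.1 hm with h | h
      · exact (pow_le_pow_left₀ (hr0 _) h _).trans ih
      · refine (pow_le_of_le_one (hr0 _) (hr1 _) (pow_ne_zero _ hp.ne_zero)).trans ?_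
        exact h.trans ((mul_le_of_le_one_right hp0 (hr1 j)).trans hpθ)
  -- Each `p`-th power gains at least a factor `θ^(1/2)`; squaring avoids the root and accounts for
  -- the factor 2 in `2 * y ≤ j`.
  have hB : ∀ j, j ≤ n → ramProd p π (τ ^ p ^ j) ^ 2 ≤ θ ^ (2 + j) := by
    intro j
    induction j with
    | zero =>
      intro _
      refine pow_le_pow_left₀ (Finset.prod_nonneg fun _ _ =>
        (nm_nonneg p _).trans (le_max_left _ _)) ?_ 2
      rw [hθ, ← hcard, Nat.card_eq_fintype_card, ← Finset.card_univ, ← Finset.prod_const]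
      refine Finset.prod_le_prod (fun _ _ => (nm_nonneg p _).trans (le_max_left _ _)) fun σ _ => ?_
      exact max_le (nm_sub_le_of_le p (nm_aut p _ π).le le_rfl)
        (nm_sub_le_of_le p (nm_aut p _ π).le le_rfl)
    | succ j ih =>
      intro hj
      have hne : τ ^ p ^ j ≠ 1 := by
        intro h
        have := hordj j (by omega)
        rw [h, orderOf_one] at this
        exact (Nat.one_lt_pow (by omega) hp.one_lt).ne this
      have hd := aut_unif_ne hTR hπ hne
      have hdpos := nm_pos p hd
      have hrj : 0 < r j := div_pos hdpos hπ.pos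
      have h1 := ramProd_pow_le (p := p) hd p
      rw [← pow_mul, ← pow_succ, hordj (j + 1) hj] at h1
      have hc : nm p M ((τ ^ p ^ (j + 1)) π - π) / nm p M ((τ ^ p ^ j) π - π) =
          r (j + 1) / r j := by
        rw [hr]; dsimp only
        rw [div_div_div_cancel_right₀ hπ.pos.ne']
      rw [hc] at h1
      have hc0 : 0 ≤ r (j + 1) / r j := div_nonneg (hr0 _) (hr0 _)
      -- In the first case the exponent of `r j` is `2(p-1)p^(n-j-1)`, at least `p^(n-j)` since
      -- `2(p-1) ≥ p`, and `hA` applies. In the second the ratio is already at most `|p| ≤ θ`.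
      have hc2 : ((r (j + 1) / r j) ^ p ^ (n - (j + 1))) ^ 2 ≤ θ := by
        have hpm : 1 ≤ p ^ (n - (j + 1)) := Nat.one_le_pow _ _ hp.pos
        rcases le_max_iff.1 (hstep j) with h | h
        · have h2 : r (j + 1) / r j ≤ r j ^ (p - 1) := by
            rw [div_le_iff₀ hrj, ← pow_succ, Nat.sub_add_cancel hp.one_lt.le]
            exact h
          calc ((r (j + 1) / r j) ^ p ^ (n - (j + 1))) ^ 2
              ≤ ((r j ^ (p - 1)) ^ p ^ (n - (j + 1))) ^ 2 := by gcongr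
            _ = r j ^ ((p - 1) * p ^ (n - (j + 1)) * 2) := by
                rw [← pow_mul, ← pow_mul, mul_assoc]
            _ ≤ r j ^ p ^ (n - j) := by
                refine pow_le_pow_of_le_one (hr0 j) (hr1 j) ?_
                have e : n - j = (n - (j + 1)) + 1 := by omega
                rw [e, pow_succ']
                have := hp.two_le
                have h3 : p ≤ (p - 1) * 2 := by omega
                calc p * p ^ (n - (j + 1)) ≤ ((p - 1) * 2) * p ^ (n - (j + 1)) := by gcongr
                  _ = _ := by ring
            _ ≤ θ := hA j (by omega)
        · have h2 : r (j + 1) / r j ≤ nm p M (p : M) := by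
            rw [div_le_iff₀ hrj]; exact h
          have h3 : r (j + 1) / r j ≤ 1 := h2.trans (nm_prime_lt_one p).le
          rw [← pow_mul]
          exact (pow_le_of_le_one hc0 h3 (by positivity)).trans (h2.trans hpθ)
      calc ramProd p π (τ ^ p ^ (j + 1)) ^ 2
          ≤ (ramProd p π (τ ^ p ^ j) * (r (j + 1) / r j) ^ p ^ (n - (j + 1))) ^ 2 :=
            pow_le_pow_left₀ (Finset.prod_nonneg fun _ _ =>
              (nm_nonneg p _).trans (le_max_left _ _)) h1 2
        _ = ramProd p π (τ ^ p ^ j) ^ 2 * ((r (j + 1) / r j) ^ p ^ (n - (j + 1))) ^ 2 := by ring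
        _ ≤ θ ^ (2 + j) * θ := by
            gcongr
            exact ih (by omega)
        _ = θ ^ (2 + (j + 1)) := by ring
  -- For `j < n` this element has order `p^(n-j) > 1`, contradicting the triviality of the
  -- ramification group.
  have hmem : τ ^ p ^ j ∈ upperRamFinite p F M y := by
    rw [mem_upperRamFinite_iff hTR hF hπ hy]
    have h0 : 0 ≤ θ ^ (1 + y) := Real.rpow_nonneg hθ0.le _
    refine (sq_le_sq₀ (Finset.prod_nonneg fun _ _ =>
      (nm_nonneg p _).trans (le_max_left _ _)) h0).1 ((hB j hjn.le).trans ?_)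
    rw [← Real.rpow_natCast, ← Real.rpow_natCast, ← Real.rpow_mul hθ0.le]
    refine Real.rpow_le_rpow_of_exponent_ge hθ0 hθ1.le ?_
    push_cast
    linarith
  rw [hbot, Subgroup.mem_bot] at hmem
  have := hordj j hjn.le
  rw [hmem, orderOf_one] at this
  exact (Nat.one_lt_pow (by omega) hp.one_lt).ne this

end Cyclic

/-! ### The upper numbering of infinite extensions -/

lemma exists_restriction {F E M : Type*} [Field F] [Field E] [Algebra F E] [Field M] [Algebra F M]
    [Normal F M] (i : M →ₐ[F] E) (σ : Gal(E/F)) : ∃ τ : Gal(M/F), ∀ x, σ (i x) = i (τ x) := by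
  let _ : Algebra M E := i.toRingHom.toAlgebra
  have _ : IsScalarTower F M E := IsScalarTower.of_algebraMap_eq fun x => (i.commutes x).symm
  exact ⟨σ.restrictNormal M, fun x => (AlgEquiv.restrictNormal_commutes σ M x).symm⟩

lemma exists_extension {F E M : Type*} [Field F] [Field E] [Algebra F E] [Field M] [Algebra F M]
    [Normal F M] [Normal F E] (i : M →ₐ[F] E) (τ : Gal(M/F)) :
    ∃ σ : Gal(E/F), ∀ x, σ (i x) = i (τ x) := by
  let _ : Algebra M E := i.toRingHom.toAlgebra
  have _ : IsScalarTower F M E := IsScalarTower.of_algebraMap_eq fun x => (i.commutes x).symm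
  obtain ⟨σ, rfl⟩ := AlgEquiv.restrictNormalHom_surjective (F := F) (K₁ := M) E τ
  exact ⟨σ, fun x => (AlgEquiv.restrictNormal_commutes σ M x).symm⟩

section Infinite

variable {p : ℕ} [Fact p.Prime]
variable {F E : Type*} [Field F] [Field E] [Algebra F E] [Algebra ℚ_[p] F] [Algebra ℚ_[p] E]
  [IsScalarTower ℚ_[p] F E]

lemma IsTotallyRamified.tower_top [Algebra.IsAlgebraic ℚ_[p] F] [Algebra.IsAlgebraic ℚ_[p] E]
    (hTR : IsTotallyRamified p F E) (L : Type*) [Field L] [Algebra F L] [Algebra L E]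
    [Algebra ℚ_[p] L] [IsScalarTower ℚ_[p] F L] [IsScalarTower ℚ_[p] L E] [IsScalarTower F L E]
    [Algebra.IsAlgebraic ℚ_[p] L] : IsTotallyRamified p L E := by
  rw [isTotallyRamified_iff] at hTR ⊢
  intro x hx
  obtain ⟨y, hy, hxy⟩ := hTR x hx
  refine ⟨algebraMap F L y, by rwa [nm_algebraMap], ?_⟩
  rwa [← IsScalarTower.algebraMap_apply F L E]

lemma mem_upperRam_iff (σ : Gal(E/F)) (u : ℝ) : σ ∈ upperRam p F E u ↔
    ∀ M : FiniteGaloisIntermediateField F E,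
      AlgEquiv.restrictNormalHom (M : IntermediateField F E) σ ∈ upperRamFinite p F M u := by
  simp only [upperRam, Subgroup.mem_iInf, Subgroup.mem_comap]

variable [FiniteDimensional ℚ_[p] F] [IsGalois F E]

/-- The finite Galois intermediate field which is the image of a finite Galois extension. -/
noncomputable def galoisRange {M : Type*} [Field M] [Algebra F M] [FiniteDimensional F M] [IsGalois F M]
    (i : M →ₐ[F] E) : FiniteGaloisIntermediateField F E where
  toIntermediateField := i.fieldRange
  finiteDimensional := i.equivFieldRange.toLinearEquiv.finiteDimensional
  isGalois := IsGalois.of_algEquiv i.equivFieldRange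

variable (F) in
lemma isAlgebraic_padic_of_isGalois (p : ℕ) [Fact p.Prime] [Algebra ℚ_[p] F] [Algebra ℚ_[p] E]
    [IsScalarTower ℚ_[p] F E] [FiniteDimensional ℚ_[p] F] : Algebra.IsAlgebraic ℚ_[p] E :=
  Algebra.IsAlgebraic.trans ℚ_[p] F E

lemma mem_upperRamFinite_of_mem_upperRam (hTR : IsTotallyRamified p F E) {M : Type*} [Field M]
    [Algebra F M] [Algebra ℚ_[p] M] [IsScalarTower ℚ_[p] F M] [FiniteDimensional F M]
    [IsGalois F M] (i : M →ₐ[F] E) {u : ℝ} (hu : 0 ≤ u) {σ : Gal(E/F)}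
    (hσ : σ ∈ upperRam p F E u) {τ : Gal(M/F)} (hτ : ∀ x, σ (i x) = i (τ x)) :
    τ ∈ upperRamFinite p F M u := by
  have _ := isAlgebraic_padic_of_isGalois F (E := E) p
  let M₀ := galoisRange i
  have _ : Algebra.IsAlgebraic ℚ_[p] M₀ := Algebra.IsAlgebraic.trans ℚ_[p] F M₀
  have h := (mem_upperRam_iff σ u).1 hσ M₀
  refine (upperRamFinite_quotient (hTR.of_algHom M₀.val) (M := M₀)
    (i.equivFieldRange : M →ₐ[F] i.fieldRange) hu τ).2 ⟨_, h, fun x => ?_⟩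
  apply Subtype.ext
  exact (AlgEquiv.restrictNormal_commutes σ M₀ (i.equivFieldRange x)).trans (hτ x)

lemma mem_upperRam_of_finite (hTR : IsTotallyRamified p F E) [FiniteDimensional F E] {u : ℝ}
    (hu : 0 ≤ u) {σ : Gal(E/F)} (hσ : σ ∈ upperRamFinite p F E u) : σ ∈ upperRam p F E u := by
  rw [mem_upperRam_iff]
  intro M
  exact (upperRamFinite_quotient hTR M.val hu _).2 ⟨σ, hσ, fun x =>
    (AlgEquiv.restrictNormal_commutes σ M x).symm⟩

/-- The upper ramification groups of a quotient lift. -/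
theorem exists_lift_mem_upperRam (hTR : IsTotallyRamified p F E) {E' : Type*} [Field E']
    [Algebra F E'] [Algebra ℚ_[p] E'] [IsScalarTower ℚ_[p] F E'] [IsGalois F E']
    (i : E' →ₐ[F] E) {u : ℝ} (hu : 0 ≤ u) {σ' : Gal(E'/F)} (hσ' : σ' ∈ upperRam p F E' u) :
    ∃ σ ∈ upperRam p F E u, ∀ x, σ (i x) = i (σ' x) := by
  have _ := isAlgebraic_padic_of_isGalois F (E := E) p
  have _ := isAlgebraic_padic_of_isGalois F (E := E') p
  have hTR' : IsTotallyRamified p F E' := hTR.of_algHom i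
  have hTRM : ∀ M : FiniteGaloisIntermediateField F E, IsTotallyRamified p F M := fun M =>
    have _ : Algebra.IsAlgebraic ℚ_[p] M := Algebra.IsAlgebraic.trans ℚ_[p] F M
    hTR.of_algHom M.val
  -- `C M` consists of the `σ` that solve the problem at level `M`: the restriction to `M` is in the
  -- ramification group and agrees with `σ'` on `M ∩ i(E')`. These sets are closed and directed, so
  -- compactness of the Galois group yields a common element.
  let C : FiniteGaloisIntermediateField F E → Set Gal(E/F) := fun M =>
    {σ | ∃ τ ∈ upperRamFinite p F M u, (∀ x, σ (M.val x) = M.val (τ x)) ∧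
      ∀ x, ∀ h : i x ∈ M.toIntermediateField, ((τ ⟨i x, h⟩ : M) : E) = i (σ' x)}
  have hclosed : ∀ M, IsClosed (C M) := by
    intro M
    have : C M = AlgEquiv.restrictNormalHom (M : IntermediateField F E) ⁻¹'
        {τ | τ ∈ upperRamFinite p F M u ∧
          ∀ x, ∀ h : i x ∈ M.toIntermediateField, ((τ ⟨i x, h⟩ : M) : E) = i (σ' x)} := by
      ext σ
      constructor
      · rintro ⟨τ, h1, h2, h3⟩
        have : AlgEquiv.restrictNormalHom (M : IntermediateField F E) σ = τ := by
          ext x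
          exact (AlgEquiv.restrictNormal_commutes σ M x).trans (h2 x)
        rw [Set.mem_preimage, this]
        exact ⟨h1, h3⟩
      · rintro ⟨h1, h3⟩
        exact ⟨_, h1, fun x => (AlgEquiv.restrictNormal_commutes σ M x).symm, h3⟩
    rw [this]
    exact (isClosed_discrete _).preimage (InfiniteGalois.restrictNormalHom_continuous _)
  -- Restrict `σ'` to `N = M ∩ i(E')`, lift it from `N` to `M` by Herbrand's theorem, and extend
  -- arbitrarily to `E`.
  have hnonempty : ∀ M, (C M).Nonempty := by
    intro M
    have _ : IsGalois F i.fieldRange := IsGalois.of_algEquiv i.equivFieldRange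
    let N : IntermediateField F E := M.toIntermediateField ⊓ i.fieldRange
    have _ : IsGalois F N := inferInstanceAs
      (IsGalois F ↑(M.toIntermediateField ⊓ i.fieldRange))
    have _ : FiniteDimensional F N := inferInstanceAs
      (FiniteDimensional F ↑(M.toIntermediateField ⊓ i.fieldRange))
    let j : N →ₐ[F] E' := (i.equivFieldRange.symm : i.fieldRange →ₐ[F] E').comp
      (IntermediateField.inclusion inf_le_right)
    have hj : ∀ z, i (j z) = z := fun z =>
      congrArg Subtype.val (i.equivFieldRange.apply_symm_apply
        (IntermediateField.inclusion inf_le_right z))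
    obtain ⟨τ', hτ'⟩ := exists_restriction j σ'
    have h1 := mem_upperRamFinite_of_mem_upperRam hTR' j hu hσ' hτ'
    let k : N →ₐ[F] M := IntermediateField.inclusion inf_le_left
    obtain ⟨τ, hτ, hττ⟩ := (upperRamFinite_quotient (hTRM M) k hu τ').1 h1
    obtain ⟨σ, hσ⟩ := exists_extension M.val τ
    refine ⟨σ, τ, hτ, hσ, fun x h => ?_⟩
    let z : N := ⟨i x, h, x, rfl⟩
    have hz : j z = x := i.injective (hj z)
    have h2 := congrArg Subtype.val (hττ z)
    change ((τ (k z) : M) : E) = _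
    rw [h2, ← hz, hτ', hj]
    rfl
  have hanti : ∀ M N : FiniteGaloisIntermediateField F E, M ≤ N → C N ⊆ C M := by
    rintro M N hMN σ ⟨τ, hτ, h1, h2⟩
    obtain ⟨ρ, hρ⟩ := exists_restriction M.val σ
    refine ⟨ρ, (upperRamFinite_quotient (hTRM N) (IntermediateField.inclusion hMN) hu ρ).2
      ⟨τ, hτ, fun x => ?_⟩, hρ, fun x h => ?_⟩
    · apply Subtype.ext
      exact (h1 (IntermediateField.inclusion hMN x)).symm.trans (hρ x)
    · exact ((hρ ⟨i x, h⟩).symm.trans (h1 ⟨i x, hMN h⟩)).trans (h2 x (hMN h))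
  obtain ⟨σ, hσ⟩ := IsCompact.nonempty_iInter_of_directed_nonempty_isCompact_isClosed C
    (fun M N => ⟨M ⊔ N, hanti _ _ le_sup_left, hanti _ _ le_sup_right⟩) hnonempty
    (fun M => (hclosed M).isCompact) hclosed
  rw [Set.mem_iInter] at hσ
  refine ⟨σ, (mem_upperRam_iff σ u).2 fun M => ?_, fun x => ?_⟩
  · obtain ⟨τ, hτ, h1, -⟩ := hσ M
    have : AlgEquiv.restrictNormalHom (M : IntermediateField F E) σ = τ := by
      ext x
      exact (AlgEquiv.restrictNormal_commutes σ M x).trans (h1 x)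
    rwa [this]
  · obtain ⟨τ, -, h1, h2⟩ := hσ (FiniteGaloisIntermediateField.adjoin F {i x})
    have hx : i x ∈ (FiniteGaloisIntermediateField.adjoin F {i x}).toIntermediateField :=
      FiniteGaloisIntermediateField.subset_adjoin F {i x} rfl
    exact (h1 ⟨i x, hx⟩).trans (h2 x hx)

lemma isClosed_upperRam (u : ℝ) : IsClosed (upperRam p F E u : Set Gal(E/F)) := by
  have : (upperRam p F E u : Set Gal(E/F)) = ⋂ M : FiniteGaloisIntermediateField F E,
      AlgEquiv.restrictNormalHom (M : IntermediateField F E) ⁻¹' (upperRamFinite p F M u) := by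
    ext σ
    simp [mem_upperRam_iff]
  rw [this]
  exact isClosed_iInter fun M =>
    (isClosed_discrete _).preimage (InfiniteGalois.restrictNormalHom_continuous _)

lemma lowerRam_normal {M : Type*} [Field M] [Algebra F M] [Algebra ℚ_[p] M]
    [IsScalarTower ℚ_[p] F M] [FiniteDimensional ℚ_[p] M] [FiniteDimensional F M] [IsGalois F M]
    (hTR : IsTotallyRamified p F M) (s : ℝ) : (lowerRam p F M s).Normal := by
  refine ⟨fun σ hσ τ => ?_⟩
  obtain ⟨π, hπ⟩ := exists_isUnif p M
  rw [hTR.mem_lowerRam_iff hπ] at hσ ⊢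
  refine le_trans ?_ hσ
  have e : (τ * σ * τ⁻¹) π - π = τ (σ (τ⁻¹ π) - τ⁻¹ π) := by
    rw [map_sub, ← AlgEquiv.mul_apply τ τ⁻¹, mul_inv_cancel]
    rfl
  rw [e, nm_aut]
  exact hTR.nm_sub_le hπ σ ((nm_aut p _ _).trans_le hπ.lt_one.le)

lemma upperRam_normal (hTR : IsTotallyRamified p F E) (u : ℝ) : (upperRam p F E u).Normal := by
  have _ := isAlgebraic_padic_of_isGalois F (E := E) p
  have h : ∀ M : FiniteGaloisIntermediateField F E, ((upperRamFinite p F M u).comap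
      (AlgEquiv.restrictNormalHom (M : IntermediateField F E) : Gal(E/F) →* Gal(M/F))).Normal := fun M => by
    have _ : FiniteDimensional ℚ_[p] M := FiniteDimensional.trans ℚ_[p] F M
    exact (lowerRam_normal (hTR.of_algHom M.val) _).comap _
  exact Subgroup.normal_iInf_normal (a := fun M : FiniteGaloisIntermediateField F E =>
    (upperRamFinite p F M u).comap
      (AlgEquiv.restrictNormalHom (M : IntermediateField F E) : Gal(E/F) →* Gal(M/F))) h

end Infinite

/-! ### Change of base field in infinite extensions -/

section BaseChange

variable {p : ℕ} [Fact p.Prime]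
variable {K L E : Type*} [Field K] [Field L] [Field E] [Algebra K L] [Algebra K E] [Algebra L E]
  [IsScalarTower K L E] [Algebra ℚ_[p] K] [Algebra ℚ_[p] L] [Algebra ℚ_[p] E]
  [IsScalarTower ℚ_[p] K E] [IsScalarTower ℚ_[p] L E] [IsScalarTower ℚ_[p] K L]
  [FiniteDimensional ℚ_[p] K] [FiniteDimensional K L] [IsGalois K E]

variable (K L E) in
/-- A finite Galois extension of `K` in `E` that contains `M` and `L`. -/
lemma exists_finiteGalois_ge (M : FiniteGaloisIntermediateField K E) :
    ∃ N : FiniteGaloisIntermediateField K E, M ≤ N ∧ ∀ x : L, algebraMap L E x ∈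
      N.toIntermediateField := by
  let L₀ := (IsScalarTower.toAlgHom K L E).fieldRange
  have _ : FiniteDimensional K L₀ :=
    (IsScalarTower.toAlgHom K L E).equivFieldRange.toLinearEquiv.finiteDimensional
  let N₀ : FiniteGaloisIntermediateField K E :=
    { IntermediateField.normalClosure K L₀ E with
      finiteDimensional := normalClosure.is_finiteDimensional K L₀ E
      isGalois := IsGalois.normalClosure K L₀ E }
  refine ⟨M ⊔ N₀, le_sup_left, fun x => ?_⟩
  have h1 : N₀ ≤ M ⊔ N₀ := le_sup_right
  exact h1 (IntermediateField.le_normalClosure L₀ ⟨x, rfl⟩)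

theorem restrictScalars_mem_upperRam (hTR : IsTotallyRamified p K E) {πK : K}
    (hK : IsUnif p πK) [FiniteDimensional ℚ_[p] L] {πL : L} (hL : IsUnif p πL) {e : ℕ}
    (he : nm p K πK = nm p L πL ^ e) {x y : ℝ} (hx : 0 ≤ x) (hy : 0 ≤ y)
    (hxy : (e : ℝ) * (1 + x) = 1 + y) {σ : Gal(E/L)} (hσ : σ ∈ upperRam p L E y) :
    σ.restrictScalars K ∈ upperRam p K E x := by
  have _ := isAlgebraic_padic_of_isGalois K (E := E) p
  have hTRL : IsTotallyRamified p L E := hTR.tower_top L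
  have _ : IsGalois L E := IsGalois.tower_top_of_isGalois K L E
  rw [mem_upperRam_iff]
  intro M
  obtain ⟨N, hMN, hLN⟩ := exists_finiteGalois_ge K L E M
  let _ : Algebra L N := ((algebraMap L E).codRestrict N.toIntermediateField hLN).toAlgebra
  have _ : IsScalarTower K L N := IsScalarTower.of_algebraMap_eq fun x =>
    Subtype.ext (IsScalarTower.algebraMap_apply K L E x)
  have _ : IsScalarTower ℚ_[p] L N := IsScalarTower.of_algebraMap_eq fun x =>
    Subtype.ext (IsScalarTower.algebraMap_apply ℚ_[p] L E x)
  have _ : FiniteDimensional L N := FiniteDimensional.right K L N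
  have _ : IsGalois L N := IsGalois.tower_top_of_isGalois K L N
  have _ : FiniteDimensional ℚ_[p] N := FiniteDimensional.trans ℚ_[p] K N
  let i : N →ₐ[L] E := { algebraMap N E with commutes' := fun x => rfl }
  obtain ⟨τ, hτ⟩ := exists_restriction i σ
  have h1 := mem_upperRamFinite_of_mem_upperRam hTRL i hy hσ hτ
  have hTRN : IsTotallyRamified p K N := hTR.of_algHom N.val
  have h2 := restrictScalars_mem_upperRamFinite hTRN (hTRL.of_algHom i) hK hL he hx hy hxy h1
  refine (upperRamFinite_quotient hTRN (IntermediateField.inclusion hMN) hx _).2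
    ⟨_, h2, fun z => ?_⟩
  apply Subtype.ext
  refine Eq.trans ?_ (AlgEquiv.restrictNormal_commutes (σ.restrictScalars K) M z).symm
  exact (hτ (IntermediateField.inclusion hMN z)).symm

end BaseChange

/-! ### Closed subgroups of compact groups -/

section Group

open scoped commutatorElement

variable {G : Type*} [Group G] [TopologicalSpace G] [IsTopologicalGroup G]

lemma isOpen_of_index_ne_zero {A : Subgroup G} (hA : IsClosed (A : Set G)) (h : A.index ≠ 0) :
    IsOpen (A : Set G) :=
  have _ : A.FiniteIndex := ⟨h⟩
  A.isOpen_of_isClosed_of_finiteIndex hA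

lemma index_ne_zero_of_isOpen [CompactSpace G] {A : Subgroup G} (hA : IsOpen (A : Set G)) :
    A.index ≠ 0 := by
  have _ : Finite (G ⧸ A) := A.quotient_finite_of_isOpen hA
  exact Subgroup.index_ne_zero_of_finite

/-- In a topologically finitely generated compact group, abelian quotients of finite exponent of
open subgroups are finite. -/
theorem isOpen_of_pow_mem [CompactSpace G] (hgen : IsTwoGenerated G) {V A : Subgroup G}
    (hV : IsOpen (V : Set G)) (hA : IsClosed (A : Set G)) (hAV : A ≤ V) (hcomm : ⁅V, V⁆ ≤ A)
    {n : ℕ} (hn : 0 < n) (hpow : ∀ σ ∈ V, σ ^ n ∈ A) : IsOpen (A : Set G) := by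
  obtain ⟨x, y, hxy⟩ := hgen
  set D := Subgroup.closure {x, y} with hD
  have hDd : Dense (D : Set G) := by
    rw [dense_iff_closure_eq, ← Subgroup.topologicalClosure_coe, hxy]
    rfl
  have _ : Group.FG D := (Group.fg_iff_subgroup_fg D).2
    ((Subgroup.fg_iff D).2 ⟨{x, y}, hD.symm, Set.toFinite _⟩)
  have hVi := index_ne_zero_of_isOpen hV
  have _ : V.FiniteIndex := ⟨hVi⟩
  -- A finite-index subgroup of the dense finitely generated group `D` is finitely generated. Its
  -- image in `V/A` is a finitely generated torsion abelian group, hence finite, and it is dense,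
  -- hence everything.
  have _ : Group.FG (V.subgroupOf D) := Subgroup.fg_of_index_ne_zero _
  set A₁ := A.subgroupOf V with hA₁
  have hc : ∀ a b : V, ⁅a, b⁆ ∈ A₁ := fun a b =>
    Subgroup.mem_subgroupOf.2 (hcomm (Subgroup.commutator_mem_commutator a.2 b.2))
  have _ : A₁.Normal := ⟨fun a ha b => by
    have h1 := mul_mem (hc b a) ha
    rwa [commutatorElement_def, inv_mul_cancel_right] at h1⟩
  have _ : IsClosed (A₁ : Set V) := hA.preimage continuous_subtype_val
  let _ : CommGroup (V ⧸ A₁) :=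
    { (inferInstance : Group (V ⧸ A₁)) with
      mul_comm := by
        intro a b
        induction a using QuotientGroup.induction_on with | _ a
        induction b using QuotientGroup.induction_on with | _ b
        rw [← commutatorElement_eq_one_iff_mul_comm]
        exact (QuotientGroup.eq_one_iff _).2 (hc a b) }
  let j : V.subgroupOf D →* V :=
    (D.subtype.comp (V.subgroupOf D).subtype).codRestrict V fun z => z.2
  let ψ : V.subgroupOf D →* V ⧸ A₁ := (QuotientGroup.mk' A₁).comp j
  have _ : Group.FG ψ.range := Group.fg_range ψ
  have htors : IsMulTorsion ψ.range := by
    intro z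
    refine isOfFinOrder_iff_pow_eq_one.2 ⟨n, hn, ?_⟩
    apply Subtype.ext
    obtain ⟨z, hz⟩ := z
    induction z using QuotientGroup.induction_on with | _ v
    exact (QuotientGroup.eq_one_iff (v ^ n)).2 (hpow v v.2)
  have hfin : Finite ψ.range := CommGroup.finite_of_fg_isMulTorsion _ htors
  have hjd : DenseRange j := by
    intro v
    rw [mem_closure_iff_nhds]
    intro U hU
    obtain ⟨U', hU', hUU'⟩ := mem_nhds_subtype _ _ _ |>.1 hU
    obtain ⟨d, ⟨hd1, hd2⟩, hd3⟩ := hDd.inter_nhds_nonempty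
      (Filter.inter_mem hU' (hV.mem_nhds v.2)) |>.imp fun d hd => (⟨hd.2, hd.1⟩ : (d ∈ _ ∧ d ∈ D))
    exact ⟨⟨d, hd2⟩, hUU' hd1, ⟨⟨⟨d, hd3⟩, hd2⟩, rfl⟩⟩
  have hψd : DenseRange ψ :=
    (QuotientGroup.mk_surjective (s := A₁)).denseRange.comp hjd QuotientGroup.continuous_mk
  have huniv : Set.range ψ = Set.univ := by
    have : (Set.range ψ).Finite := hfin
    rw [← this.isClosed.closure_eq]
    exact hψd.closure_range
  have hfinq : Finite (V ⧸ A₁) := by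
    rw [← Set.finite_univ_iff, ← huniv]
    exact hfin
  refine isOpen_of_index_ne_zero hA ?_
  rw [← Subgroup.relIndex_mul_index hAV]
  exact mul_ne_zero Subgroup.index_ne_zero_of_finite hVi

lemma isClosed_sup_of_normal [CompactSpace G] [T2Space G] {X Y : Subgroup G}
    (hX : IsClosed (X : Set G)) (hY : IsClosed (Y : Set G)) [Y.Normal] :
    IsClosed ((X ⊔ Y : Subgroup G) : Set G) := by
  rw [Subgroup.mul_normal]
  exact (hX.isCompact.mul hY.isCompact).isClosed

/-- Modulo `R`, the commutator of `xr` and `ys` is that of `x` and `y`, which lies in both normal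
subgroups. -/
lemma commutator_sup_sup_le (X Y R : Subgroup G) [X.Normal] [Y.Normal] [R.Normal] :
    ⁅X ⊔ R, Y ⊔ R⁆ ≤ (X ⊓ Y) ⊔ R := by
  rw [Subgroup.commutator_le]
  intro a ha b hb
  obtain ⟨x, hx, r, hr, rfl⟩ := Subgroup.mem_sup_of_normal_right.1 ha
  obtain ⟨y, hy, s, hs, rfl⟩ := Subgroup.mem_sup_of_normal_right.1 hb
  have h1 : ⁅x, y⁆ ∈ X ⊓ Y :=
    Subgroup.commutator_le_inf X Y (Subgroup.commutator_mem_commutator hx hy)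
  have h2 : ⁅x, y⁆⁻¹ * ⁅x * r, y * s⁆ ∈ R := by
    rw [← QuotientGroup.eq_one_iff]
    have hr' : (r : G ⧸ R) = 1 := (QuotientGroup.eq_one_iff r).2 hr
    have hs' : (s : G ⧸ R) = 1 := (QuotientGroup.eq_one_iff s).2 hs
    simp only [commutatorElement_def, QuotientGroup.mk_mul, QuotientGroup.mk_inv, hr', hs',
      mul_one]
    group
  rw [← mul_inv_cancel_left ⁅x, y⁆ ⁅x * r, y * s⁆]
  exact Subgroup.mul_mem_sup h1 h2

/-- If `R` is open modulo each of finitely many normal subgroups with trivial intersection, and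
abelian quotients of open subgroups by groups that contain `R` are finite, then `R` is open. -/
theorem isOpen_of_isOpen_sup [CompactSpace G] [T2Space G] {ι : Type*} [Finite ι]
    {R : Subgroup G} [R.Normal] (hR : IsClosed (R : Set G)) (N : ι → Subgroup G)
    [∀ k, (N k).Normal] (hN : ∀ k, IsClosed (N k : Set G)) (hbot : ⨅ k, N k = ⊥)
    (hNR : ∀ k, IsOpen ((N k ⊔ R : Subgroup G) : Set G))
    (hab : ∀ V A : Subgroup G, IsOpen (V : Set G) → IsClosed (A : Set G) → A ≤ V → R ≤ A →
      ⁅V, V⁆ ≤ A → IsOpen (A : Set G)) : IsOpen (R : Set G) := by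
  classical
  have _ := Fintype.ofFinite ι
  -- To add an index `k`, intersect `V` with `N k ⊔ R` and replace the result `W` by the closure of
  -- `[W, W] R`: still open by `hab`, and contained in the smaller group by `commutator_sup_sup_le`.
  -- For all indices the bound is `R` itself.
  have key : ∀ S : Finset ι, ∃ V : Subgroup G, IsOpen (V : Set G) ∧ R ≤ V ∧
      V ≤ (⨅ k ∈ S, N k) ⊔ R := by
    intro S
    induction S using Finset.induction_on with
    | empty => exact ⟨⊤, isOpen_univ, le_top, by simp⟩
    | insert k S _ ih =>
      obtain ⟨V, hV, hRV, hVS⟩ := ih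
      set W := V ⊓ (N k ⊔ R) with hW
      have hWo : IsOpen (W : Set G) := hV.inter (hNR k)
      have hRW : R ≤ W := le_inf hRV le_sup_right
      have hWW : ⁅W, W⁆ ≤ W := Subgroup.commutator_le.2 fun a ha b hb =>
        mul_mem (mul_mem (mul_mem ha hb) (inv_mem ha)) (inv_mem hb)
      have _ : (⨅ k ∈ S, N k).Normal :=
        Subgroup.normal_iInf_normal fun k => Subgroup.normal_iInf_normal fun _ => inferInstance
      have hSc : IsClosed ((⨅ k ∈ S, N k : Subgroup G) : Set G) := by
        simp only [Subgroup.coe_iInf]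
        exact isClosed_biInter fun k _ => hN k
      refine ⟨(⁅W, W⁆ ⊔ R).topologicalClosure, ?_, ?_, ?_⟩
      · refine hab W _ hWo (Subgroup.isClosed_topologicalClosure _) ?_ ?_ ?_
        · exact Subgroup.topologicalClosure_minimal _ (sup_le hWW hRW) (W.isClosed_of_isOpen hWo)
        · exact le_sup_right.trans (Subgroup.le_topologicalClosure _)
        · exact le_sup_left.trans (Subgroup.le_topologicalClosure _)
      · exact le_sup_right.trans (Subgroup.le_topologicalClosure _)
      · rw [Finset.iInf_insert, inf_comm]
        refine Subgroup.topologicalClosure_minimal _ (sup_le ?_ le_sup_right) ?_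
        · exact (Subgroup.commutator_mono (inf_le_left.trans hVS) inf_le_right).trans
            (commutator_sup_sup_le _ _ _)
        · exact isClosed_sup_of_normal (hSc.inter (hN k)) hR
  obtain ⟨V, hV, hRV, hVS⟩ := key Finset.univ
  have : R = V := le_antisymm hRV (by simpa [hbot] using hVS)
  rw [this]
  exact hV

/-- Openness of `N R` is not affected if the normal subgroup `R` is shrunk to `R ⊓ H` with `H`
open and normal. -/
lemma isOpen_sup_inf_of_isOpen [CompactSpace G] [T2Space G] {N R H : Subgroup G} [N.Normal]
    [R.Normal] [H.Normal] (hN : IsClosed (N : Set G)) (hR : IsClosed (R : Set G))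
    (hH : IsOpen (H : Set G)) (hNR : IsOpen ((N ⊔ R : Subgroup G) : Set G)) :
    IsOpen ((N ⊔ (R ⊓ H) : Subgroup G) : Set G) := by
  refine isOpen_of_index_ne_zero (isClosed_sup_of_normal hN (hR.inter (H.isClosed_of_isOpen hH))) ?_
  have h1 : (N ⊔ (R ⊓ H)) ⊔ R = N ⊔ R := by
    rw [sup_assoc, sup_eq_right.2 (inf_le_left : R ⊓ H ≤ R)]
  rw [← Subgroup.relIndex_mul_index (le_sup_left : N ⊔ (R ⊓ H) ≤ (N ⊔ (R ⊓ H)) ⊔ R), h1]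
  refine mul_ne_zero ?_ (index_ne_zero_of_isOpen hNR)
  rw [← h1, Subgroup.relIndex_sup_left]
  refine mt (Subgroup.relIndex_eq_zero_of_le_left (le_sup_right : R ⊓ H ≤ _)) ?_
  rw [Subgroup.inf_relIndex_left]
  exact fun h => index_ne_zero_of_isOpen hH (Subgroup.index_eq_zero_of_relIndex_eq_zero h)

end Group

/-! ### Abelian extensions with bounded ramification -/

open scoped commutatorElement in
lemma normal_of_commutator_mem {G : Type*} [Group G] {A : Subgroup G}
    (h : ∀ a b : G, ⁅a, b⁆ ∈ A) : A.Normal :=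
  ⟨fun a ha b => by
    have h1 := mul_mem (h b a) ha
    rwa [commutatorElement_def, inv_mul_cancel_right] at h1⟩

open scoped commutatorElement in
-- A complex character of the finite abelian group `G/A` separates `g` from 1; its image, a finite
-- subgroup of `ℂˣ`, is cyclic.
lemma exists_cyclic_quotient {G : Type*} [Group G] [Finite G] {A : Subgroup G}
    (h : ∀ a b : G, ⁅a, b⁆ ∈ A) {g : G} (hg : g ∉ A) :
    ∃ B : Subgroup G, ∃ _ : B.Normal, A ≤ B ∧ g ∉ B ∧ IsCyclic (G ⧸ B) := by
  have _ := normal_of_commutator_mem h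
  let _ : CommGroup (G ⧸ A) :=
    { (inferInstance : Group (G ⧸ A)) with
      mul_comm := by
        intro a b
        induction a using QuotientGroup.induction_on with | _ a
        induction b using QuotientGroup.induction_on with | _ b
        rw [← commutatorElement_eq_one_iff_mul_comm]
        exact (QuotientGroup.eq_one_iff _).2 (h a b) }
  have hg1 : (g : G ⧸ A) ≠ 1 := fun h1 => hg ((QuotientGroup.eq_one_iff g).1 h1)
  have _ : NeZero (Monoid.exponent (G ⧸ A)) := ⟨Monoid.exponent_ne_zero_of_finite⟩
  obtain ⟨φ, hφ⟩ := CommGroup.exists_apply_ne_one_of_hasEnoughRootsOfUnity (G ⧸ A) ℂ hg1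
  let ψ : G →* ℂˣ := φ.comp (QuotientGroup.mk' A)
  refine ⟨ψ.ker, inferInstance, fun a ha => ?_, hφ, ?_⟩
  · have : (a : G ⧸ A) = 1 := (QuotientGroup.eq_one_iff a).2 ha
    change φ (a : G ⧸ A) = 1
    rw [this, map_one]
  · have _ : Finite ψ.range := Set.finite_range ψ
    have _ : IsCyclic ψ.range := inferInstance
    exact isCyclic_of_surjective (QuotientGroup.quotientKerEquivRange ψ).symm
      (QuotientGroup.quotientKerEquivRange ψ).symm.surjective

section Abelian

variable {p : ℕ} [Fact p.Prime]

open scoped commutatorElement in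
-- Otherwise some cyclic quotient detects `σ^(p^j)`. The corresponding cyclic extension has trivial
-- ramification group at `y`, hence degree at most `p^j`, which kills this power.
theorem pow_mem_of_upperRamFinite_le {L M : Type*} [Field L] [Field M] [Algebra L M]
    [Algebra ℚ_[p] L] [Algebra ℚ_[p] M] [IsScalarTower ℚ_[p] L M] [FiniteDimensional ℚ_[p] L]
    [FiniteDimensional L M] [IsGalois L M] (hTR : IsTotallyRamified p L M)
    (hpG : IsPGroup p Gal(M/L)) {y : ℝ} (hy : 0 ≤ y) {A : Subgroup Gal(M/L)}
    (hcomm : ∀ a b : Gal(M/L), ⁅a, b⁆ ∈ A) (hA : upperRamFinite p L M y ≤ A) {j : ℕ}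
    (hj : 2 * y ≤ j) (σ : Gal(M/L)) : σ ^ p ^ j ∈ A := by
  by_contra hσ
  obtain ⟨B, _, hAB, hσB, hcyc⟩ := exists_cyclic_quotient hcomm hσ
  have _ : FiniteDimensional ℚ_[p] M := FiniteDimensional.trans ℚ_[p] L M
  let N := IntermediateField.fixedField B
  let f := IsGalois.normalAutEquivQuotient B
  have _ : IsGalois L N := IsGalois.of_fixedField_normal_subgroup B
  have _ : IsCyclic Gal(N/L) := isCyclic_of_surjective f f.surjective
  have hpN : IsPGroup p Gal(N/L) := (hpG.to_quotient B).of_equiv f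
  obtain ⟨n, hn⟩ := IsPGroup.iff_card.1 hpN
  have _ : FiniteDimensional ℚ_[p] N := FiniteDimensional.trans ℚ_[p] L N
  have hbot : upperRamFinite p L N y = ⊥ := by
    rw [eq_bot_iff]
    intro τ hτ
    obtain ⟨ρ, hρ, hρτ⟩ := (upperRamFinite_quotient hTR N.val hy τ).1 hτ
    rw [Subgroup.mem_bot]
    ext z
    change N.val (τ z) = z
    rw [← hρτ]
    exact z.2 ⟨ρ, hAB (hA hρ)⟩
  have hnj := le_of_upperRamFinite_eq_bot (hTR.of_algHom N.val) hn hy hbot hj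
  apply hσB
  have h1 : ((σ : Gal(M/L)) : Gal(M/L) ⧸ B) ^ p ^ j = 1 := by
    rw [← orderOf_dvd_iff_pow_eq_one]
    refine (orderOf_dvd_natCard _).trans ?_
    rw [Nat.card_congr f.toEquiv, hn]
    exact pow_dvd_pow p hnj
  exact (QuotientGroup.eq_one_iff (σ ^ p ^ j)).1 h1

variable {K E : Type*} [Field K] [Field E] [Algebra K E] [Algebra ℚ_[p] K] [Algebra ℚ_[p] E]
  [IsScalarTower ℚ_[p] K E] [FiniteDimensional ℚ_[p] K] [IsGalois K E]

lemma IsUnif.exists_ramificationIndex_pos {L : Type*} [Field L] [Algebra K L]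
    [Algebra ℚ_[p] L] [IsScalarTower ℚ_[p] K L] [FiniteDimensional ℚ_[p] L] {πK : K}
    (hK : IsUnif p πK) {πL : L} (hL : IsUnif p πL) :
    ∃ e : ℕ, 1 ≤ e ∧ nm p K πK = nm p L πL ^ e := by
  obtain ⟨e, he⟩ := hK.exists_ramificationIndex hL
  refine ⟨e, Nat.one_le_iff_ne_zero.2 fun h => ?_, he⟩
  have := hK.lt_one
  rw [he, h, pow_zero] at this
  exact lt_irrefl _ this

/-- An upper ramification group of `E / K` contains one of `E / L`. -/
lemma exists_upperRam_le (hTR : IsTotallyRamified p K E) {x : ℝ} (hx : 0 ≤ x) (L : Type*)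
    [Field L] [Algebra K L] [Algebra L E] [Algebra ℚ_[p] L] [IsScalarTower K L E]
    [IsScalarTower ℚ_[p] L E] [IsScalarTower ℚ_[p] K L] [FiniteDimensional K L] :
    ∃ y : ℝ, 0 ≤ y ∧ ∀ σ ∈ upperRam p L E y, σ.restrictScalars K ∈ upperRam p K E x := by
  have _ : FiniteDimensional ℚ_[p] L := FiniteDimensional.trans ℚ_[p] K L
  obtain ⟨πK, hK⟩ := exists_isUnif p K
  obtain ⟨πL, hL⟩ := exists_isUnif p L
  obtain ⟨e, he1, he⟩ := hK.exists_ramificationIndex_pos hL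
  have he1' : (1 : ℝ) ≤ e := by exact_mod_cast he1
  -- Dividing `1 + y` by the ramification index `e` gives `1 + x`, as base change requires.
  have hy : (0 : ℝ) ≤ e * (1 + x) - 1 := by nlinarith
  exact ⟨e * (1 + x) - 1, hy, fun σ hσ =>
    restrictScalars_mem_upperRam hTR hK hL he hx hy (by ring) hσ⟩

lemma isPGroup_of_isProP (hpro : IsProP p Gal(E/K)) (N : FiniteGaloisIntermediateField K E) :
    IsPGroup p Gal(N/K) := by
  let f : Gal(E/K) →* Gal(N/K) := AlgEquiv.restrictNormalHom (N : IntermediateField K E)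
  have hf : Function.Surjective f := AlgEquiv.restrictNormalHom_surjective E
  have ho : IsOpen (f.ker : Set Gal(E/K)) :=
    (isOpen_discrete {(1 : Gal(N/K))}).preimage
      (InfiniteGalois.restrictNormalHom_continuous (N : IntermediateField K E))
  obtain ⟨n, hn⟩ := hpro.index_eq_pow f.ker inferInstance ho
  rw [Subgroup.index_ker, MonoidHom.range_eq_top.2 hf, Subgroup.card_top] at hn
  exact IsPGroup.of_card hn

open scoped commutatorElement in
-- With `V = Gal(E/L)`, the group `A` contains `Gal(E/L)^y` for some `y`. The exponent bound of
-- `pow_mem_of_upperRamFinite_le` depends only on `y`, so it holds uniformly in all finite layers.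
theorem exists_pow_mem (hTR : IsTotallyRamified p K E) (hpro : IsProP p Gal(E/K)) {x : ℝ}
    (hx : 0 ≤ x) {V A : Subgroup Gal(E/K)} (hV : IsOpen (V : Set Gal(E/K)))
    (hA : IsClosed (A : Set Gal(E/K))) (hRA : upperRam p K E x ⊓ V ≤ A) (hcomm : ⁅V, V⁆ ≤ A) :
    ∃ m : ℕ, ∀ σ ∈ V, σ ^ p ^ m ∈ A := by
  have _ := isAlgebraic_padic_of_isGalois K (E := E) p
  let L := IntermediateField.fixedField V
  have hLV : L.fixingSubgroup = V :=
    InfiniteGalois.fixingSubgroup_fixedField ⟨V, V.isClosed_of_isOpen hV⟩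
  have _ : FiniteDimensional K L := by
    rw [← InfiniteGalois.isOpen_iff_finite, hLV]
    exact hV
  have _ : FiniteDimensional ℚ_[p] L := FiniteDimensional.trans ℚ_[p] K L
  have _ : IsGalois L E := IsGalois.tower_top_of_isGalois K L E
  have hTRL : IsTotallyRamified p L E := hTR.tower_top L
  have hresV : ∀ ρ : Gal(E/L), ρ.restrictScalars K ∈ V := by
    intro ρ
    rw [← hLV, IntermediateField.mem_fixingSubgroup_iff]
    exact fun z hz => ρ.commutes ⟨z, hz⟩
  obtain ⟨y, hy, hyx⟩ := exists_upperRam_le hTR hx L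
  refine ⟨⌈2 * y⌉₊, fun σ hσ => ?_⟩
  set s := σ ^ p ^ ⌈2 * y⌉₊ with hs
  by_contra hsA
  -- As `A` is closed, `s ∉ A` is visible at a finite layer: the coset `s Gal(E/M)` misses `A`.
  obtain ⟨M, hMfin, hMnor, hMA⟩ := (krullTopology_mem_nhds_one_iff_of_normal K E
    ((fun τ => s * τ) ⁻¹' (A : Set Gal(E/K))ᶜ)).1
    ((hA.isOpen_compl.preimage (continuous_const_mul s)).mem_nhds (by simpa using hsA))
  have _ : IsGalois K M := ⟨⟩
  obtain ⟨N, hMN, hLN⟩ := exists_finiteGalois_ge K L E (⟨M⟩ : FiniteGaloisIntermediateField K E)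
  let _ : Algebra L N := ((algebraMap L E).codRestrict N.toIntermediateField hLN).toAlgebra
  have _ : IsScalarTower K L N := IsScalarTower.of_algebraMap_eq fun x =>
    Subtype.ext (IsScalarTower.algebraMap_apply K L E x)
  have _ : IsScalarTower ℚ_[p] L N := IsScalarTower.of_algebraMap_eq fun x =>
    Subtype.ext (IsScalarTower.algebraMap_apply ℚ_[p] L E x)
  have _ : FiniteDimensional L N := FiniteDimensional.right K L N
  have _ : IsGalois L N := IsGalois.tower_top_of_isGalois K L N
  have _ : FiniteDimensional ℚ_[p] N := FiniteDimensional.trans ℚ_[p] K N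
  have _ : IsScalarTower L N E := IsScalarTower.of_algebraMap_eq fun x => rfl
  let i : N →ₐ[L] E := { algebraMap N E with commutes' := fun x => rfl }
  have hTRN : IsTotallyRamified p L N := hTRL.of_algHom i
  let f : Gal(E/L) →* Gal(N/L) := AlgEquiv.restrictNormalHom N
  have hf : Function.Surjective f := AlgEquiv.restrictNormalHom_surjective E
  have hfi : ∀ (ρ : Gal(E/L)) (z : N), ρ (i z) = i (f ρ z) := fun ρ z =>
    (AlgEquiv.restrictNormal_commutes ρ N z).symm
  let A' : Subgroup Gal(N/L) := (A.comap (AlgEquiv.restrictScalarsHom K)).map f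
  have hcomm' : ∀ a b : Gal(N/L), ⁅a, b⁆ ∈ A' := by
    intro a b
    obtain ⟨a, rfl⟩ := hf a
    obtain ⟨b, rfl⟩ := hf b
    rw [← map_commutatorElement]
    refine Subgroup.mem_map_of_mem f (Subgroup.mem_comap.2 (hcomm ?_))
    rw [map_commutatorElement]
    exact Subgroup.commutator_mem_commutator (hresV a) (hresV b)
  have hRA' : upperRamFinite p L N y ≤ A' := by
    intro τ hτ
    obtain ⟨ρ, hρ, hρτ⟩ := exists_lift_mem_upperRam hTRL i hy (mem_upperRam_of_finite hTRN hy hτ)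
    refine ⟨ρ, hRA ⟨hyx ρ hρ, hresV ρ⟩, ?_⟩
    ext z
    exact (hfi ρ z).symm.trans (hρτ z)
  have hpG : IsPGroup p Gal(N/L) := (isPGroup_of_isProP hpro N).of_injective
    (AlgEquiv.restrictScalarsHom K : Gal(N/L) →* Gal(N/K)) fun τ τ' h => by
      ext z; exact congrArg Subtype.val (DFunLike.congr_fun h z)
  have hσ' : σ ∈ L.fixingSubgroup := hLV.symm ▸ hσ
  let σL : Gal(E/L) := AlgEquiv.ofRingEquiv (f := (σ : E ≃+* E)) fun z =>
    (IntermediateField.mem_fixingSubgroup_iff _ _).1 hσ' z z.2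
  have hσL : σL.restrictScalars K = σ := by ext z; rfl
  obtain ⟨ρ, hρA, hρ⟩ := pow_mem_of_upperRamFinite_le hTRN hpG hy hcomm' hRA'
    (Nat.le_ceil (2 * y)) (f σL)
  have hagree : ∀ z ∈ M, ρ z = s z := by
    intro z hz
    have h1 := hfi ρ ⟨z, hMN hz⟩
    have h2 := hfi (σL ^ p ^ ⌈2 * y⌉₊) ⟨z, hMN hz⟩
    rw [hρ, ← map_pow] at h1
    have h3 : (σL ^ p ^ ⌈2 * y⌉₊).restrictScalars K = s := by
      rw [hs, ← hσL]
      exact map_pow (AlgEquiv.restrictScalarsHom K) σL _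
    rw [← h3]
    exact h1.trans h2.symm
  refine hMA (a := s⁻¹ * ρ.restrictScalars K) ?_ ?_
  · rw [SetLike.mem_coe, IntermediateField.mem_fixingSubgroup_iff]
    intro z hz
    change s⁻¹ (ρ z) = z
    rw [hagree z hz, ← AlgEquiv.mul_apply, inv_mul_cancel, AlgEquiv.one_apply]
  · change s * (s⁻¹ * ρ.restrictScalars K) ∈ A
    rw [mul_inv_cancel_left]
    exact hρA

end Abelian

/-! ### Composita of arithmetically profinite extensions -/

section Compositum

variable {p : ℕ} [Fact p.Prime] {K E : Type*} [Field K] [Field E]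
  [Algebra ℚ_[p] K] [FiniteDimensional ℚ_[p] K] [Algebra K E] [Algebra ℚ_[p] E]
  [IsScalarTower ℚ_[p] K E] [IsGalois K E]

lemma exists_restrictScalars_eq {L : IntermediateField K E} {σ : Gal(E/K)}
    (hσ : σ ∈ L.fixingSubgroup) : ∃ τ : Gal(E/L), τ.restrictScalars K = σ :=
  ⟨AlgEquiv.ofRingEquiv (f := (σ : E ≃+* E)) fun z =>
    (IntermediateField.mem_fixingSubgroup_iff _ _).1 hσ z z.2, by ext z; rfl⟩

lemma conj_mem_fixingSubgroup {L E' : IntermediateField K E} (hLE : L ≤ E')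
    [IsGalois L (IntermediateField.extendScalars hLE)] {n h : Gal(E/K)}
    (hn : n ∈ E'.fixingSubgroup) (hh : h ∈ L.fixingSubgroup) :
    h * n * h⁻¹ ∈ E'.fixingSubgroup := by
  obtain ⟨g, hg⟩ := exists_restrictScalars_eq (inv_mem hh)
  obtain ⟨τ, hτ⟩ := exists_restriction (IntermediateField.extendScalars hLE).val g
  rw [IntermediateField.mem_fixingSubgroup_iff] at hn ⊢
  intro z hz
  have h1 : h⁻¹ z = (τ ⟨z, hz⟩ : E) := by
    rw [← hg]; exact hτ ⟨z, hz⟩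
  have h2 : n (τ ⟨z, hz⟩ : E) = (τ ⟨z, hz⟩ : E) := hn _ (τ ⟨z, hz⟩).2
  rw [AlgEquiv.mul_apply, AlgEquiv.mul_apply, h1, h2, ← h1, ← AlgEquiv.mul_apply,
    mul_inv_cancel, AlgEquiv.one_apply]

/-- If `E' / L` is arithmetically profinite, the upper ramification groups of `E / K` are open
modulo `Gal(E/E')`. -/
lemma isOpen_fixingSubgroup_sup_upperRam (hTR : IsTotallyRamified p K E)
    {L E' : IntermediateField K E} (hLE : L ≤ E') [FiniteDimensional K L]
    [IsGalois L (IntermediateField.extendScalars hLE)]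
    (hAPF : IsAPF p L (IntermediateField.extendScalars hLE)) {x : ℝ} (hx : 0 ≤ x) :
    IsOpen ((E'.fixingSubgroup.subgroupOf L.fixingSubgroup ⊔
      (upperRam p K E x).subgroupOf L.fixingSubgroup : Subgroup L.fixingSubgroup) :
        Set L.fixingSubgroup) := by
  have _ := isAlgebraic_padic_of_isGalois K (E := E) p
  have _ : FiniteDimensional ℚ_[p] L := FiniteDimensional.trans ℚ_[p] K L
  have _ : IsGalois L E := IsGalois.tower_top_of_isGalois K L E
  let Ek := IntermediateField.extendScalars hLE
  obtain ⟨y, hy, hyx⟩ := exists_upperRam_le hTR hx L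
  obtain ⟨M, hMfin, -, hMU⟩ := (krullTopology_mem_nhds_one_iff_of_normal L Ek
    (upperRam p L Ek y : Set Gal(Ek/L))).1
    ((hAPF.isOpen_upperRam y hy).mem_nhds (one_mem _))
  let M₁ : IntermediateField L E := M.map Ek.val
  have _ : FiniteDimensional L M₁ := (M.equivMap Ek.val).toLinearEquiv.finiteDimensional
  let M₂ : IntermediateField K E := M₁.restrictScalars K
  have _ : FiniteDimensional K M₂ := FiniteDimensional.trans K L M₁
  have hopen : IsOpen ((M₂.fixingSubgroup.subgroupOf L.fixingSubgroup :
      Subgroup L.fixingSubgroup) : Set L.fixingSubgroup) :=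
    M₂.fixingSubgroup_isOpen.preimage continuous_subtype_val
  -- An element fixing `M₂` restricts into `Gal(E'/L)^y`. Lifting that restriction to `Gal(E/L)^y`,
  -- which restricts into `G^x`, changes the element only by a factor fixing `E'`.
  refine Subgroup.isOpen_mono ?_ hopen
  intro h hh
  obtain ⟨g, hg⟩ := exists_restrictScalars_eq h.2
  obtain ⟨τ, hτ⟩ := exists_restriction Ek.val g
  have hgh : ∀ z, g z = (h : Gal(E/K)) z := fun z => by rw [← hg]; rfl
  have hτU : τ ∈ upperRam p L Ek y := by
    apply hMU
    rw [SetLike.mem_coe, IntermediateField.mem_fixingSubgroup_iff]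
    intro z hz
    apply Subtype.ext
    refine (hτ z).symm.trans ((hgh _).trans ?_)
    exact (IntermediateField.mem_fixingSubgroup_iff _ _).1 (Subgroup.mem_subgroupOf.1 hh) _
      (IntermediateField.mem_restrictScalars K |>.2 ⟨z, hz, rfl⟩)
  obtain ⟨ρ, hρ, hρτ⟩ := exists_lift_mem_upperRam (hTR.tower_top L) Ek.val hy hτU
  have hρL : ρ.restrictScalars K ∈ L.fixingSubgroup := by
    rw [IntermediateField.mem_fixingSubgroup_iff]
    exact fun z hz => ρ.commutes ⟨z, hz⟩
  let r : L.fixingSubgroup := ⟨ρ.restrictScalars K, hρL⟩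
  have hn : h * r⁻¹ ∈ E'.fixingSubgroup.subgroupOf L.fixingSubgroup := by
    rw [Subgroup.mem_subgroupOf, IntermediateField.mem_fixingSubgroup_iff]
    intro z hz
    have h1 : ρ ((τ⁻¹ ⟨z, hz⟩ : Ek) : E) = z :=
      (hρτ (τ⁻¹ ⟨z, hz⟩)).trans
        (congrArg Subtype.val (DFunLike.congr_fun (mul_inv_cancel τ) (⟨z, hz⟩ : Ek)))
    have h2 : g ((τ⁻¹ ⟨z, hz⟩ : Ek) : E) = z :=
      (hτ (τ⁻¹ ⟨z, hz⟩)).trans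
        (congrArg Subtype.val (DFunLike.congr_fun (mul_inv_cancel τ) (⟨z, hz⟩ : Ek)))
    change (h : Gal(E/K)) (ρ.symm z) = z
    rw [← hgh, ρ.symm_apply_eq.2 h1.symm, h2]
  rw [← inv_mul_cancel_right h r]
  exact Subgroup.mul_mem_sup hn (Subgroup.mem_subgroupOf.2 (hyx ρ hρ))

theorem isOpen_upperRam_of_iSup_eq_top (hTR : IsTotallyRamified p K E)
    (hpro : IsProP p Gal(E/K)) (hgen : IsTwoGenerated Gal(E/K)) {ι : Type*} [Finite ι]
    (E' L : ι → IntermediateField K E) (hE : (⨆ i, E' i) = ⊤) (hLE : ∀ i, L i ≤ E' i)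
    (hL : ∀ i, FiniteDimensional K (L i))
    (hGal : ∀ i, IsGalois (L i) (IntermediateField.extendScalars (hLE i)))
    (hAPF : ∀ i, IsAPF p (L i) (IntermediateField.extendScalars (hLE i))) {x : ℝ} (hx : 0 ≤ x) :
    IsOpen (upperRam p K E x : Set Gal(E/K)) := by
  have _ := upperRam_normal hTR x
  set R := upperRam p K E x with hRdef
  have hR : IsClosed (R : Set Gal(E/K)) := isClosed_upperRam x
  have hNcl : ∀ i, IsClosed ((E' i).fixingSubgroup : Set Gal(E/K)) := fun i =>
    InfiniteGalois.fixingSubgroup_isClosed (E' i)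
  have hcompact : ∀ V : Subgroup Gal(E/K), IsOpen (V : Set Gal(E/K)) → CompactSpace V :=
    fun V hV => isCompact_iff_compactSpace.1 (V.isClosed_of_isOpen hV).isCompact
  -- The field `E' i` is Galois over `L i` but possibly not over `K`. Inside an open normal subgroup
  -- of `Gal(E/K)` that fixes every `L i`, all `Gal(E/E' i)` become normal.
  set H₀ : Subgroup Gal(E/K) := ⨅ i, (L i).fixingSubgroup with hH₀
  have hH₀o : IsOpen (H₀ : Set Gal(E/K)) := by
    rw [hH₀, Subgroup.coe_iInf]
    exact isOpen_iInter_of_finite fun i => (L i).fixingSubgroup_isOpen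
  have _ : H₀.FiniteIndex := ⟨index_ne_zero_of_isOpen hH₀o⟩
  set H := H₀.normalCore
  have hHo : IsOpen (H : Set Gal(E/K)) :=
    H.isOpen_of_isClosed_of_finiteIndex (H₀.normalCore_isClosed (H₀.isClosed_of_isOpen hH₀o))
  have hHL : ∀ i, H ≤ (L i).fixingSubgroup := fun i => H₀.normalCore_le.trans (iInf_le _ i)
  have _ := hcompact H hHo
  have hNnormal : ∀ i, ((E' i).fixingSubgroup.subgroupOf H).Normal := fun i =>
    ⟨fun n hn h => conj_mem_fixingSubgroup (hLE i) hn (hHL i h.2)⟩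
  have hNR : ∀ i, IsOpen (((E' i).fixingSubgroup.subgroupOf H ⊔ R.subgroupOf H :
      Subgroup H) : Set H) := by
    intro i
    have _ := hcompact (L i).fixingSubgroup (L i).fixingSubgroup_isOpen
    have _ : ((E' i).fixingSubgroup.subgroupOf (L i).fixingSubgroup).Normal :=
      ⟨fun n hn h => conj_mem_fixingSubgroup (hLE i) hn h.2⟩
    have h1 := isOpen_sup_inf_of_isOpen (H := H.subgroupOf (L i).fixingSubgroup)
      ((hNcl i).preimage continuous_subtype_val) (hR.preimage continuous_subtype_val)
      (hHo.preimage continuous_subtype_val)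
      (isOpen_fixingSubgroup_sup_upperRam hTR (hLE i) (hAPF i) hx)
    have h2 : IsOpen ((((E' i).fixingSubgroup.subgroupOf (L i).fixingSubgroup ⊔
        R.subgroupOf (L i).fixingSubgroup ⊓ H.subgroupOf (L i).fixingSubgroup).comap
        (Subgroup.inclusion (hHL i)) : Subgroup H) : Set H) :=
      h1.preimage (continuous_subtype_val.subtype_mk fun h : H => hHL i h.2)
    refine Subgroup.isOpen_mono ?_ h2
    intro h hh
    obtain ⟨n, hn, r, hr, hnr⟩ := Subgroup.mem_sup_of_normal_right.1 (Subgroup.mem_comap.1 hh)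
    let r' : H := ⟨r, hr.2⟩
    have hn' : h * r'⁻¹ ∈ (E' i).fixingSubgroup.subgroupOf H := by
      rw [Subgroup.mem_subgroupOf]
      have : ((h * r'⁻¹ : H) : Gal(E/K)) = n := by
        have h3 : (n : Gal(E/K)) * r = h := congrArg Subtype.val hnr
        change (h : Gal(E/K)) * (r : Gal(E/K))⁻¹ = n
        rw [← h3, mul_inv_cancel_right]
      rw [this]
      exact hn
    rw [← inv_mul_cancel_right h r']
    exact Subgroup.mul_mem_sup hn' (Subgroup.mem_subgroupOf.2 hr.1)
  have hbot : ⨅ i, (E' i).fixingSubgroup.subgroupOf H = ⊥ := by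
    rw [eq_bot_iff]
    intro σ hσ
    rw [Subgroup.mem_iInf] at hσ
    have h1 : (⨆ i, E' i) ≤ IntermediateField.fixedField (Subgroup.zpowers (σ : Gal(E/K))) :=
      iSup_le fun i => (IntermediateField.le_iff_le _ _).2
        ((Subgroup.zpowers_le).2 (Subgroup.mem_subgroupOf.1 (hσ i)))
    rw [hE, IntermediateField.le_iff_le, IntermediateField.fixingSubgroup_top,
      Subgroup.zpowers_le, Subgroup.mem_bot] at h1
    exact Subgroup.mem_bot.2 (Subtype.ext h1)
  have key : IsOpen ((R.subgroupOf H : Subgroup H) : Set H) := by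
    refine isOpen_of_isOpen_sup (hR.preimage continuous_subtype_val)
      (fun i => (E' i).fixingSubgroup.subgroupOf H)
      (fun i => (hNcl i).preimage continuous_subtype_val) hbot hNR ?_
    -- Subgroups of `H` are carried to `Gal(E/K)`, where bounded ramification gives finite exponent
    -- and two-generation gives finiteness.
    intro V A hV hA hAV hRA hcomm
    have hV' : IsOpen ((V.map H.subtype : Subgroup Gal(E/K)) : Set Gal(E/K)) :=
      hHo.isOpenMap_subtype_val _ hV
    have hA' : IsClosed ((A.map H.subtype : Subgroup Gal(E/K)) : Set Gal(E/K)) :=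
      (H.isClosed_of_isOpen hHo).isClosedMap_subtype_val _ hA
    have hcomm' : ⁅V.map H.subtype, V.map H.subtype⁆ ≤ A.map H.subtype := by
      rw [← Subgroup.map_commutator]
      exact Subgroup.map_mono hcomm
    have hRA' : R ⊓ V.map H.subtype ≤ A.map H.subtype := by
      rintro _ ⟨h1, v, -, rfl⟩
      exact ⟨v, hRA (Subgroup.mem_subgroupOf.2 h1), rfl⟩
    obtain ⟨m, hm⟩ := exists_pow_mem hTR hpro hx hV' hA' hRA' hcomm'
    have h1 := isOpen_of_pow_mem hgen hV' hA' (Subgroup.map_mono hAV) hcomm'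
      (pow_pos (Fact.out : p.Prime).pos m) hm
    have h2 : A = (A.map H.subtype).comap H.subtype :=
      (Subgroup.comap_map_eq_self_of_injective H.subtype_injective A).symm
    rw [h2]
    exact h1.preimage continuous_subtype_val
  refine Subgroup.isOpen_mono (H₁ := (R.subgroupOf H).map H.subtype) ?_
    (hHo.isOpenMap_subtype_val _ key)
  rintro _ ⟨r, hr, rfl⟩
  exact hr

/-- A totally ramified compositum of finitely many arithmetically profinite extensions is
arithmetically profinite. -/
theorem isAPF_of_iSup_eq_top (hTR : IsTotallyRamified p K E)
    (hpro : IsProP p Gal(E/K)) (hgen : IsTwoGenerated Gal(E/K)) {ι : Type*} [Finite ι]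
    [Nonempty ι] (E' L : ι → IntermediateField K E) (hE : (⨆ i, E' i) = ⊤)
    (hLE : ∀ i, L i ≤ E' i) (hL : ∀ i, FiniteDimensional K (L i))
    (hGal : ∀ i, IsGalois (L i) (IntermediateField.extendScalars (hLE i)))
    (hAPF : ∀ i, IsAPF p (L i) (IntermediateField.extendScalars (hLE i))) : IsAPF p K E where
  totallyRamified := hTR
  isOpen_upperRam _ hx := isOpen_upperRam_of_iSup_eq_top hTR hpro hgen E' L hE hLE hL hGal hAPF hx
  upperRam_ne_bot x hx hbot := by
    obtain ⟨k⟩ := ‹Nonempty ι›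
    have _ := isAlgebraic_padic_of_isGalois K (E := E) p
    have _ : FiniteDimensional ℚ_[p] (L k) := FiniteDimensional.trans ℚ_[p] K (L k)
    have _ : IsGalois (L k) E := IsGalois.tower_top_of_isGalois K (L k) E
    obtain ⟨y, hy, hyx⟩ := exists_upperRam_le hTR hx (L k)
    refine (hAPF k).upperRam_ne_bot y hy ((Subgroup.eq_bot_iff_forall _).2 fun τ hτ => ?_)
    obtain ⟨ρ, hρ, hρτ⟩ := exists_lift_mem_upperRam (hTR.tower_top (L k))
      (IntermediateField.extendScalars (hLE k)).val hy hτ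
    have h1 := hyx ρ hρ
    rw [hbot, Subgroup.mem_bot] at h1
    ext z
    exact (hρτ z).symm.trans (DFunLike.congr_fun h1 (z : E))

end Compositum

theorem corollary4p4 (p : ℕ) [Fact p.Prime] {K E : Type*} [Field K] [Field E]
    [Algebra ℚ_[p] K] [FiniteDimensional ℚ_[p] K] [Algebra K E] [Algebra ℚ_[p] E]
    [IsScalarTower ℚ_[p] K E]
    -- `E / K` is a totally ramified Galois pro-`p`-extension, `Gal(E/K)` having two generators
    [IsGalois K E] (hram : IsTotallyRamified p K E) (hpro : IsProP p Gal(E/K))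
    (hgen : IsTwoGenerated Gal(E/K))
    -- `E` is the compositum of finitely many `E_i / K`, with `L_i / K` finite inside `E_i / K`
    {ι : Type*} [Finite ι] [Nonempty ι] (E' L : ι → IntermediateField K E)
    (hE : (⨆ i, E' i) = ⊤) (hLE : ∀ i, L i ≤ E' i) (hL : ∀ i, FiniteDimensional K (L i))
    -- each `E_i / L_i` is a `C`-extension, with `C`-tower `c i`
    (c : ∀ i, ℕ → Gal(IntermediateField.extendScalars (hLE i)/L i))
    (hc : ∀ i, IsCExtensionWith p (L i) (IntermediateField.extendScalars (hLE i)) (c i))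
    -- `a i` is a lift of the `C`-tower `c i` to a tower in `Gal(E/K)`
    (a : ι → ℕ → Gal(E/K)) (ha : ∀ i, SatisfiesCTowerRelations (a i))
    (hac : ∀ i j, ∀ x : IntermediateField.extendScalars (hLE i), a i j (x : E) = (c i j x : E))
    -- the condition on the upper ramification breaks in `Gal(E/K)`
    (hu : ∀ k l, k ≠ l → ∀ j,
      upperBreak p (a k j * a l j) = min (upperBreak p (a k j)) (upperBreak p (a l j)))
    -- all the `E_i / L_i` are arithmetically profinite
    (hAPF : ∀ i, IsAPF p (L i) (IntermediateField.extendScalars (hLE i))) :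
    IsAPF p K E :=
  isAPF_of_iSup_eq_top hram hpro hgen E' L hE hLE hL (fun i => (hc i).1) hAPF
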